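/- **Lemma (near-maximal distillable entanglement in the input).** There is an absolute constant $K>0$ with the following property. Let $q\ge 2$ be an integer, let $B,C$ be qudits with Hilbert space $\mathbb C^q$, and let $A,D$ be auxiliary systems with finite-dimensional Hilbert spaces. Let $\rho_{ABCD}=|\psi\rangle\langle\psi|$ be a pure state, let $u$ be a unitary acting on $BC$, whose outputs are called $B'C'$, and let $\rho_{AB'C'D}=(1_A\otimes u\otimes 1_D)\,\rho_{ABCD}\,(1_A\otimes u\otimes 1_D)^\dagger$ be the output state. Let $S(X)$ be the von Neumann entropy (natural logarithm) of the reduced state on $X$, in the input state for $X=AB$ and in the output state for $X=AB'$. Suppose that $$S(AB')-S(AB)=2\ln q-\epsilon .$$ Let $A_1,D_1$ be finite-dimensional systems and let $A_2,D_2$ be qudits of dimension $q$. If $\dim A=q\dim A_1$ and $\dim D=q\dim D_1$, so that $A=A_1A_2$ and $D=D_1D_2$ are partitions, then there are unitaries $U_A$ on $A$ and $U_D$ on $D$, pure states $|\alpha\rangle_{A_2B}$ and $|\beta\rangle_{CD_2}$ that are maximally entangled, i.e. $S(A_2)_\alpha=S(D_2)_\beta=\ln q$, and a density matrix $\sigma_{A_1D_1}$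 such that $$\bigl\|\,(U_A\otimes U_D)\,\rho_{ABCD}\,(U_A\otimes U_D)^\dagger-|\alpha\rangle\langle\alpha|_{A_2B}\otimes\sigma_{A_1D_1}\otimes|\beta\rangle\langle\beta|_{CD_2}\bigr\|_1\le K\,\epsilon^{1/2},$$ where $\|\cdot\|_1$ is the trace norm and $U_A\otimes U_D$ acts as the identity on $BC$. If, more generally, $\dim A\le q\dim A_1$ and $\dim D\le q\dim D_1$, the same holds with isometries $V_A:A\to A_1A_2$ and $V_D:D\to D_1D_2$ in place of $U_A$ and $U_D$; such an isometry is unitary whenever the dimensions agree. -/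

import Mathlib

open scoped Kronecker ComplexOrder

noncomputable section

namespace QuditGrowth

/-- The density matrix `|ψ⟩⟨ψ|` of a vector `ψ`. -/
def pureState {n : Type*} (ψ : n → ℂ) : Matrix n n ℂ :=
  Matrix.of fun i j => ψ i * star (ψ j)

/-- Normalisation of a state vector, for the Hilbert-space norm. -/
def IsUnitVector {n : Type*} [Fintype n] (ψ : n → ℂ) : Prop :=
  ∑ i, ‖ψ i‖ ^ 2 = 1

/-- Density matrices: positive semidefinite matrices of trace one. -/
def IsDensityMatrix {n : Type*} [Fintype n] (ρ : Matrix n n ℂ) : Prop :=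
  ρ.PosSemidef ∧ ρ.trace = 1

/-- Reduced matrix on the first factor: the partial trace over the second factor. -/
def traceRight {m n : Type*} [Fintype n] (M : Matrix (m × n) (m × n) ℂ) : Matrix m m ℂ :=
  Matrix.of fun i j => ∑ k, M (i, k) (j, k)

/-- The von Neumann entropy `S(ρ) = - tr (ρ ln ρ)` of a Hermitian matrix, computed from its
eigenvalues with `0 ln 0 = 0`. The value for a matrix which is not Hermitian is a dummy. -/
def entropy {n : Type*} [Fintype n] [DecidableEq n] (ρ : Matrix n n ℂ) : ℝ :=
  open Classical in
  if h : ρ.IsHermitian then ∑ i, Real.negMulLog (h.eigenvalues i) else 0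

/-- The trace norm `‖M‖₁ = tr √(Mᴴ M)`, the sum of the singular values. -/
def traceNorm {n : Type*} [Fintype n] [DecidableEq n] (M : Matrix n n ℂ) : ℝ :=
  ∑ i, Real.sqrt ((Matrix.isHermitian_conjTranspose_mul_self M).eigenvalues i)

/-- The index set of the four-party system `ABCD`, where `B` and `C` are qudits of dimension `q`,
written along the cut `AB | CD`. -/
abbrev Four (q : ℕ) (A D : Type*) : Type _ := (A × Fin q) × (Fin q × D)

/-- The operator `1_A ⊗ u_{BC} ⊗ 1_D`. -/
def gate {q : ℕ} {A D : Type*} [DecidableEq A] [DecidableEq D]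
    (u : Matrix (Fin q × Fin q) (Fin q × Fin q) ℂ) : Matrix (Four q A D) (Four q A D) ℂ :=
  Matrix.of fun x y =>
    if x.1.1 = y.1.1 ∧ x.2.2 = y.2.2 then u (x.1.2, x.2.1) (y.1.2, y.2.1) else 0

/-- The operator `V_A ⊗ 1_B ⊗ 1_C ⊗ V_D`. -/
def localOp (q : ℕ) {A D A' D' : Type*} (VA : Matrix A' A ℂ) (VD : Matrix D' D ℂ) :
    Matrix (Four q A' D') (Four q A D) ℂ :=
  (VA ⊗ₖ (1 : Matrix (Fin q) (Fin q) ℂ)) ⊗ₖ ((1 : Matrix (Fin q) (Fin q) ℂ) ⊗ₖ VD)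

/-- `ψ` is a maximally entangled unit vector of two qudits: its reduced state on the first qudit
has entropy `ln q`. -/
def IsMaximallyEntangled {q : ℕ} (ψ : Fin q × Fin q → ℂ) : Prop :=
  IsUnitVector ψ ∧ entropy (traceRight (pureState ψ)) = Real.log q

/-- The matrix `|α⟩⟨α|_{A₂B} ⊗ σ_{A₁D₁} ⊗ |β⟩⟨β|_{D₂C}` of the system `ABCD`, where
`A = A₁A₂` and `D = D₁D₂`; a basis vector of `ABCD` has the index `(((a₁, a₂), b), (c, (d₁, d₂)))`. -/
def distilled {q : ℕ} {A₁ D₁ : Type*} (α : Fin q × Fin q → ℂ)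
    (σ : Matrix (A₁ × D₁) (A₁ × D₁) ℂ) (β : Fin q × Fin q → ℂ) :
    Matrix (Four q (A₁ × Fin q) (D₁ × Fin q)) (Four q (A₁ × Fin q) (D₁ × Fin q)) ℂ :=
  Matrix.of fun x y =>
    pureState α (x.1.1.2, x.1.2) (y.1.1.2, y.1.2) *
      σ (x.1.1.1, x.2.2.1) (y.1.1.1, y.2.2.1) *
      pureState β (x.2.2.2, x.2.1) (y.2.2.2, y.2.1)

end QuditGrowth

end

namespace QuditGrowth

open Matrix
open scoped Matrix.Norms.L2Operator

/-! A gate on `BC` does not change the reduced state of `A`, so subadditivity gives S(AB') ≤ ln q +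
S(A), and the growth assumption forces S(AB) ≤ S(A) - ln q + ε. The state is pure, so S(A) = S(BCD)
and S(AB) = S(CD), and this reads D(ρ_BCD ‖ 1/q ⊗ ρ_CD) ≤ ε: the qudit `B` is almost maximally mixed
and almost decoupled from `CD`.

Relative entropy dominates the squared Hilbert-Schmidt distance of the square roots
(`sum_mul_sq_sqrt_sub_sqrt_le`), with no dimensional factor. An Uhlmann-type argument carries this
bound over to purifications: some isometry on `A` moves ψ close to Φ ⊗ N, with Φ maximally entangled
on `A₂B` (`exists_isometry_near_of_diagonal`). An exact purification of 1/q ⊗ ρ_CD may not fit into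
`A₁A₂`. But ρ_BCD has rank at most dim A ≤ q dim A₁, and therefore keeping only dim A₁ eigenvectors
of ρ_CD costs one more ε (`exists_finset_truncation_le`).

The same holds on the `D` side, where S(AB) = S(CD) plays the symmetric role. The two isometries act
on different systems, so both estimates apply to one vector; a partial inner product with Φ merges
them (`hsSq_sub_entangledProduct_contraction_le`). All squared vector distances are linear in ε, and
the trace norm of a difference of pure states is linear in the vector distance, whence the rate
ε^(1/2). -/

/-! ### Spectral decomposition and entropy -/

theorem exists_unitary_diagonalization {n : Type*} [Fintype n] [DecidableEq n]
    {H : Matrix n n ℂ} (hH : H.IsHermitian) :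
    ∃ U : Matrix n n ℂ, Uᴴ * U = 1 ∧ U * Uᴴ = 1 ∧
      H = U * diagonal (fun i => (hH.eigenvalues i : ℂ)) * Uᴴ := by
  refine ⟨hH.eigenvectorUnitary, ?_, ?_, ?_⟩
  · exact Unitary.coe_star_mul_self _
  · exact Unitary.coe_mul_star_self _
  · conv_lhs => rw [hH.spectral_theorem, Unitary.conjStarAlgAut_apply]
    rfl

theorem entropy_of_isHermitian {n : Type*} [Fintype n] [DecidableEq n]
    {H : Matrix n n ℂ} (hH : H.IsHermitian) :
    entropy H = ∑ i, Real.negMulLog (hH.eigenvalues i) := by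
  simp [entropy, hH]

theorem entropy_eq_sum_roots {n : Type*} [Fintype n] [DecidableEq n]
    {H : Matrix n n ℂ} (hH : H.IsHermitian) :
    entropy H = (H.charpoly.roots.map fun z : ℂ => Real.negMulLog z.re).sum := by
  rw [entropy_of_isHermitian hH, hH.roots_charpoly_eq_eigenvalues, Multiset.map_map]
  rfl

theorem entropy_transpose {n : Type*} [Fintype n] [DecidableEq n]
    {H : Matrix n n ℂ} (hH : H.IsHermitian) : entropy Hᵀ = entropy H := by
  rw [entropy_eq_sum_roots hH, entropy_eq_sum_roots hH.transpose, charpoly_transpose]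

/-- The two characteristic polynomials agree up to powers of X, and the additional zero roots
contribute 0 ln 0 = 0. For a pure state this is the equality of the entropies of complementary
subsystems. -/
theorem entropy_mul_conjTranspose_self {m n : Type*} [Fintype m] [Fintype n] [DecidableEq m]
    [DecidableEq n] (M : Matrix m n ℂ) : entropy (M * Mᴴ) = entropy (Mᴴ * M) := by
  have h := congrArg (fun p : Polynomial ℂ => (p.roots.map fun z : ℂ => Real.negMulLog z.re).sum)
    (charpoly_mul_comm' M Mᴴ)
  have h0 : ∀ (k : ℕ) (p : Polynomial ℂ), p ≠ 0 →
      (((Polynomial.X ^ k * p).roots).map fun z : ℂ => Real.negMulLog z.re).sum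
        = (p.roots.map fun z : ℂ => Real.negMulLog z.re).sum := by
    intro k p hp
    rw [Polynomial.roots_mul (mul_ne_zero (pow_ne_zero _ Polynomial.X_ne_zero) hp)]
    simp [Multiset.map_nsmul, Multiset.sum_nsmul]
  simp only [h0 _ _ (charpoly_monic _).ne_zero] at h
  rw [entropy_eq_sum_roots (isHermitian_mul_conjTranspose_self M),
    entropy_eq_sum_roots (isHermitian_conjTranspose_mul_self M), h]

/-! ### Contractions, isometries and polar decomposition -/

theorem norm_entry_le_l2_opNorm {m n : Type*} [Fintype m] [Fintype n] [DecidableEq n]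
    (K : Matrix m n ℂ) (i : m) (j : n) : ‖K i j‖ ≤ ‖K‖ := by
  have h := l2_opNorm_mulVec K (EuclideanSpace.single j (1 : ℂ))
  have h2 := PiLp.norm_apply_le (WithLp.toLp 2 (K *ᵥ (EuclideanSpace.single j (1 : ℂ)).ofLp)) i
  simp at h h2
  exact h2.trans h

/-- The C*-identity, used twice, gives ‖X‖² = ‖X‖⁴. The hypothesis says that X is a partial
isometry. -/
theorem l2_opNorm_le_one_of_idempotent {m n : Type*} [Fintype m] [Fintype n] [DecidableEq m]
    [DecidableEq n] (X : Matrix m n ℂ) (h : (Xᴴ * X) * (Xᴴ * X) = Xᴴ * X) : ‖X‖ ≤ 1 := by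
  have h1 : ‖Xᴴ * X‖ = ‖X‖ * ‖X‖ := l2_opNorm_conjTranspose_mul_self X
  have h2 := l2_opNorm_conjTranspose_mul_self (Xᴴ * X)
  rw [conjTranspose_mul, conjTranspose_conjTranspose, h, h1] at h2
  by_contra hc
  push Not at hc
  have h3 : 1 < ‖X‖ * ‖X‖ := by nlinarith
  nlinarith

/-- The columns of F are orthogonal with squared lengths p i. The nonzero ones are normalised, and
the rest are filled in by extending to an orthonormal basis of the larger space. -/
theorem exists_isometry_mul_diagonal {a a' : Type*} [Fintype a] [Fintype a'] [DecidableEq a]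
    [DecidableEq a'] (hcard : Fintype.card a ≤ Fintype.card a') (F : Matrix a' a ℂ) (p : a → ℝ)
    (hF : Fᴴ * F = diagonal fun i => (p i : ℂ)) (hp : ∀ i, 0 ≤ p i) :
    ∃ V : Matrix a' a ℂ, Vᴴ * V = 1 ∧ F = V * diagonal fun i => ((Real.sqrt (p i) : ℝ) : ℂ) := by
  obtain ⟨e⟩ := Function.Embedding.nonempty_of_card_le hcard
  classical
  let v : a' → EuclideanSpace ℂ a' := fun x =>
    WithLp.toLp 2 fun y =>
      if h : ∃ i, e i = x then F y h.choose * ((Real.sqrt (p h.choose))⁻¹ : ℝ) else 0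
  have hve : ∀ i, v (e i) = WithLp.toLp 2 fun y => F y i * ((Real.sqrt (p i))⁻¹ : ℝ) := by
    intro i
    have h : ∃ j, e j = e i := ⟨i, rfl⟩
    have h2 : h.choose = i := e.injective h.choose_spec
    simp only [v, dif_pos h, h2]
  let s : Set a' := {x | ∃ i, p i ≠ 0 ∧ e i = x}
  have hFF : ∀ i j, ∑ y, star (F y i) * F y j = if i = j then (p i : ℂ) else 0 := by
    intro i j
    have := congrFun (congrFun hF i) j
    simpa [mul_apply, diagonal_apply] using this
  have hv : Orthonormal ℂ (s.domRestrict v) := by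
    rw [orthonormal_iff_ite]
    rintro ⟨x, i, hi, rfl⟩ ⟨y, j, hj, rfl⟩
    have : inner ℂ (v (e i)) (v (e j)) = ((Real.sqrt (p i))⁻¹ : ℝ) * ((Real.sqrt (p j))⁻¹ : ℝ) *
        (if i = j then (p i : ℂ) else 0) := by
      rw [← hFF, hve, hve, Finset.mul_sum]
      simp only [PiLp.inner_apply, RCLike.inner_apply]
      refine Finset.sum_congr rfl fun y _ => ?_
      simp
      ring
    simp only [Set.domRestrict_apply, this, Subtype.mk.injEq, e.injective.eq_iff]
    split_ifs with h
    · subst h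
      have hpos : 0 < p i := lt_of_le_of_ne (hp i) (Ne.symm hi)
      have h1 : (Real.sqrt (p i))⁻¹ * (Real.sqrt (p i))⁻¹ * p i = 1 := by
        rw [← mul_inv, Real.mul_self_sqrt hpos.le, inv_mul_cancel₀ hi]
      exact_mod_cast h1
    · simp
  obtain ⟨b, hb⟩ := hv.exists_orthonormalBasis_extension_of_card_eq
    (by simp : Module.finrank ℂ (EuclideanSpace ℂ a') = Fintype.card a')
  refine ⟨of fun y i => b (e i) y, ?_, ?_⟩
  · ext i j
    have h := orthonormal_iff_ite.mp b.orthonormal (e i) (e j)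
    simp only [PiLp.inner_apply, RCLike.inner_apply, e.injective.eq_iff] at h
    simp only [mul_apply, conjTranspose_apply, of_apply, one_apply, ← h]
    exact Finset.sum_congr rfl fun y _ => mul_comm _ _
  · ext y i
    simp only [mul_diagonal, of_apply]
    -- Where p i = 0 the column of F vanishes, so the arbitrary basis vector put there does no harm.
    by_cases hi : p i = 0
    · have h := hFF i i
      simp only [hi, if_true] at h
      have h2 : ∑ y, ‖F y i‖ ^ 2 = 0 := by
        have h3 : ((∑ y, ‖F y i‖ ^ 2 : ℝ) : ℂ) = 0 := by
          push_cast
          rw [← Complex.ofReal_zero, ← h]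
          refine Finset.sum_congr rfl fun y _ => ?_
          rw [Complex.star_def, Complex.conj_mul']
        exact_mod_cast h3
      have h4 := (Finset.sum_eq_zero_iff_of_nonneg (fun y _ => sq_nonneg _)).mp h2 y
        (Finset.mem_univ _)
      simp [hi] at h4 ⊢
      exact h4
    · rw [hb (e i) ⟨i, hi, rfl⟩, hve]
      have hpos : 0 < p i := lt_of_le_of_ne (hp i) (Ne.symm hi)
      have h1 : (Real.sqrt (p i))⁻¹ * Real.sqrt (p i) = 1 :=
        inv_mul_cancel₀ (Real.sqrt_pos.mpr hpos).ne'
      simp only [mul_assoc, ← Complex.ofReal_mul, h1]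
      simp

/-- Variational formula for the trace norm: the isometry in the polar decomposition of Gᴴ is optimal
among all contractions. This lets an explicit contraction be replaced by an isometry that does at
least as well. -/
theorem exists_isometry_re_trace_le {a a' : Type*} [Fintype a] [Fintype a'] [DecidableEq a]
    [DecidableEq a'] (hcard : Fintype.card a ≤ Fintype.card a') (G : Matrix a a' ℂ) :
    ∃ V : Matrix a' a ℂ, Vᴴ * V = 1 ∧
      ∀ K : Matrix a' a ℂ, ‖K‖ ≤ 1 → (K * G).trace.re ≤ (V * G).trace.re := by
  have hH := isHermitian_mul_conjTranspose_self G
  obtain ⟨U, hU, hU', hG⟩ := exists_unitary_diagonalization hH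
  set p := hH.eigenvalues
  have hp : ∀ i, 0 ≤ p i := (posSemidef_self_mul_conjTranspose G).eigenvalues_nonneg
  obtain ⟨V, hV, hF⟩ := exists_isometry_mul_diagonal hcard (Gᴴ * U) p (by
    rw [conjTranspose_mul, conjTranspose_conjTranspose, Matrix.mul_assoc, ← Matrix.mul_assoc G, hG]
    simp only [← Matrix.mul_assoc, hU, Matrix.one_mul]
    rw [Matrix.mul_assoc, hU, Matrix.mul_one]) hp
  have hG2 : G = U * diagonal (fun i => ((Real.sqrt (p i) : ℝ) : ℂ)) * Vᴴ := by
    have h1 : Gᴴ = V * diagonal (fun i => ((Real.sqrt (p i) : ℝ) : ℂ)) * Uᴴ := by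
      rw [← hF, Matrix.mul_assoc, hU', Matrix.mul_one]
    have h2 := congrArg conjTranspose h1
    rw [conjTranspose_conjTranspose] at h2
    rw [h2, conjTranspose_mul, conjTranspose_mul, conjTranspose_conjTranspose,
      diagonal_conjTranspose, Matrix.mul_assoc]
    congr 3
    ext i
    simp
  have hVn : ‖Vᴴ‖ ≤ 1 := by
    rw [l2_opNorm_conjTranspose]
    exact l2_opNorm_le_one_of_idempotent V (by simp [hV])
  have hUn : ‖U‖ ≤ 1 := l2_opNorm_le_one_of_idempotent U (by simp [hU])
  have key : ∀ K : Matrix a' a ℂ, (K * G).trace.re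
      = ∑ i, Real.sqrt (p i) * ((Vᴴ * K * U) i i).re := by
    intro K
    have : (K * G).trace
        = ((Vᴴ * K * U) * diagonal (fun i => ((Real.sqrt (p i) : ℝ) : ℂ))).trace := by
      rw [hG2, ← Matrix.mul_assoc, ← Matrix.mul_assoc, trace_mul_comm]
      simp only [Matrix.mul_assoc]
    rw [this, trace, Complex.re_sum]
    refine Finset.sum_congr rfl fun i _ => ?_
    simp [mul_diagonal, mul_comm]
  refine ⟨V * Uᴴ, ?_, fun K hK => ?_⟩
  · rw [conjTranspose_mul, conjTranspose_conjTranspose, Matrix.mul_assoc, ← Matrix.mul_assoc Vᴴ, hV,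
      Matrix.one_mul, hU']
  · rw [key, key]
    refine Finset.sum_le_sum fun i _ => mul_le_mul_of_nonneg_left ?_ (Real.sqrt_nonneg _)
    have h1 : Vᴴ * (V * Uᴴ) * U = 1 := by
      rw [← Matrix.mul_assoc, hV, Matrix.one_mul, hU]
    rw [h1]
    simp only [one_apply_eq, Complex.one_re]
    refine (Complex.re_le_norm _).trans ((norm_entry_le_l2_opNorm _ i i).trans ?_)
    calc ‖Vᴴ * K * U‖ ≤ ‖Vᴴ‖ * ‖K‖ * ‖U‖ :=
          (l2_opNorm_mul _ _).trans (mul_le_mul_of_nonneg_right (l2_opNorm_mul _ _) (norm_nonneg _))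
      _ ≤ 1 * 1 * 1 := by gcongr
      _ = 1 := by norm_num

/-! ### Relative entropy and the distance of square roots -/

/-- This is ln x ≤ x - 1 at x = √s / √P, multiplied by 2P. -/
theorem sq_sqrt_sub_sqrt_le {P s : ℝ} (hP : 0 ≤ P) (hs : 0 ≤ s) (h : s = 0 → P = 0) :
    (Real.sqrt P - Real.sqrt s) ^ 2 ≤ P * Real.log P - P * Real.log s - P + s := by
  rcases eq_or_lt_of_le hP with hP0 | hP0
  · subst hP0
    simp [Real.sq_sqrt hs]
  rcases eq_or_lt_of_le hs with hs0 | hs0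
  · exact absurd (h hs0.symm) hP0.ne'
  have hx : 0 < Real.sqrt s / Real.sqrt P := by positivity
  have h1 := Real.log_le_sub_one_of_pos hx
  rw [Real.log_div (by positivity) (by positivity), Real.log_sqrt hs, Real.log_sqrt hP] at h1
  have h2 : P * (Real.sqrt s / Real.sqrt P) = Real.sqrt P * Real.sqrt s := by
    have : Real.sqrt P ≠ 0 := by positivity
    field_simp
    rw [Real.sq_sqrt hP]
  have h3 := mul_le_mul_of_nonneg_left h1 hP
  nlinarith [Real.sq_sqrt hP, Real.sq_sqrt hs]

/-- With m the squared overlaps of the eigenbases of ρ and σ, the left side is ‖√ρ - √σ‖₂² and the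
right side is D(ρ‖σ). The support condition is essential, since `Real.log 0 = 0`. -/
theorem sum_mul_sq_sqrt_sub_sqrt_le {ι κ : Type*} [Fintype ι] [Fintype κ] {p : ι → ℝ} {s : κ → ℝ}
    {m : ι → κ → ℝ} (hp : ∀ i, 0 ≤ p i) (hs : ∀ k, 0 ≤ s k) (hm : ∀ i k, 0 ≤ m i k)
    (hm1 : ∀ i, ∑ k, m i k = 1) (hm2 : ∀ k, ∑ i, m i k = 1) (hps : ∑ i, p i = ∑ k, s k)
    (hsupp : ∀ i k, s k = 0 → p i * m i k = 0) :
    ∑ i, ∑ k, m i k * (Real.sqrt (p i) - Real.sqrt (s k)) ^ 2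
      ≤ ∑ i, p i * Real.log (p i) - ∑ k, (∑ i, p i * m i k) * Real.log (s k) := by
  have h1 : ∀ i k, m i k * (Real.sqrt (p i) - Real.sqrt (s k)) ^ 2
      ≤ m i k * (p i * Real.log (p i)) - p i * m i k * Real.log (s k) - m i k * p i
        + m i k * s k := by
    intro i k
    rcases eq_or_lt_of_le (hm i k) with h | h
    · simp [← h]
    · have := mul_le_mul_of_nonneg_left (sq_sqrt_sub_sqrt_le (hp i) (hs k) fun h0 => by
        rcases mul_eq_zero.mp (hsupp i k h0) with h' | h'
        · exact h'
        · exact absurd h' h.ne') (hm i k)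
      linarith
  have e1 : ∑ i, ∑ k, m i k * (p i * Real.log (p i)) = ∑ i, p i * Real.log (p i) :=
    Finset.sum_congr rfl fun i _ => by rw [← Finset.sum_mul, hm1, one_mul]
  have e2 : ∑ i, ∑ k, p i * m i k * Real.log (s k) = ∑ k, (∑ i, p i * m i k) * Real.log (s k) := by
    rw [Finset.sum_comm]
    exact Finset.sum_congr rfl fun k _ => by rw [Finset.sum_mul]
  have e3 : ∑ i, ∑ k, m i k * p i = ∑ i, p i :=
    Finset.sum_congr rfl fun i _ => by rw [← Finset.sum_mul, hm1, one_mul]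
  have e4 : ∑ i, ∑ k, m i k * s k = ∑ k, s k := by
    rw [Finset.sum_comm]
    exact Finset.sum_congr rfl fun k _ => by rw [← Finset.sum_mul, hm2, one_mul]
  have h2 := Finset.sum_le_sum fun i (_ : i ∈ Finset.univ) =>
    Finset.sum_le_sum fun k (_ : k ∈ Finset.univ) => h1 i k
  simp only [Finset.sum_add_distrib, Finset.sum_sub_distrib, e1, e2, e3, e4] at h2
  linarith

/-! ### Truncation to few eigenvalues -/

theorem exists_finset_card_eq_forall_le {ι : Type*} [Fintype ι] [DecidableEq ι] (f : ι → ℝ) (k : ℕ)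
    (hk : k ≤ Fintype.card ι) :
    ∃ S : Finset ι, S.card = k ∧ ∀ i ∈ S, ∀ j ∉ S, f j ≤ f i := by
  induction k with
  | zero => exact ⟨∅, rfl, by simp⟩
  | succ k ih =>
    obtain ⟨S, hS, hle⟩ := ih (by omega)
    have hne : (Sᶜ).Nonempty := by
      rw [← Finset.card_pos, Finset.card_compl]
      omega
    obtain ⟨x, hx, hmax⟩ := Finset.exists_max_image Sᶜ f hne
    have hxS : x ∉ S := Finset.mem_compl.mp hx
    refine ⟨insert x S, by rw [Finset.card_insert_of_notMem hxS, hS], fun i hi j hj => ?_⟩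
    have hjS : j ∉ S := fun h => hj (Finset.mem_insert_of_mem h)
    rcases Finset.mem_insert.mp hi with rfl | hi
    · exact hmax j (Finset.mem_compl.mpr hjS)
    · exact hle i hi j hjS

/-- Bathtub principle: among weights in [0, 1] of total mass at most k, none captures more of f than
the indicator of its k largest values. -/
theorem exists_finset_tail_le {ι : Type*} [Fintype ι] [DecidableEq ι] (f : ι → ℝ) (k : ℕ) :
    ∃ S : Finset ι, S.card ≤ k ∧ ∀ w : ι → ℝ, (∀ i, 0 ≤ w i) → (∀ i, w i ≤ 1) →
      ∑ i, w i ≤ k → (∀ i, 0 ≤ f i) → ∑ i ∈ Sᶜ, f i ≤ ∑ i, f i * (1 - w i) := by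
  by_cases hk : Fintype.card ι ≤ k
  · refine ⟨Finset.univ, by simpa using hk, fun w _ hw1 _ hf => ?_⟩
    simpa using Finset.sum_nonneg fun i _ => mul_nonneg (hf i) (sub_nonneg.mpr (hw1 i))
  · push Not at hk
    obtain ⟨S, hS, hle⟩ := exists_finset_card_eq_forall_le f k hk.le
    refine ⟨S, hS.le, fun w hw0 hw1 hw hf => ?_⟩
    have hne : (Sᶜ).Nonempty := by
      rw [← Finset.card_pos, Finset.card_compl]
      omega
    obtain ⟨x, hx, hmax⟩ := Finset.exists_max_image Sᶜ f hne
    have hxS : x ∉ S := Finset.mem_compl.mp hx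
    rw [← Finset.sum_add_sum_compl S] at hw ⊢
    have h1 : ∑ i ∈ S, f x * (1 - w i) ≤ ∑ i ∈ S, f i * (1 - w i) :=
      Finset.sum_le_sum fun i hi =>
        mul_le_mul_of_nonneg_right (hle i hi x hxS) (sub_nonneg.mpr (hw1 i))
    have h2 : ∑ i ∈ Sᶜ, f i * w i ≤ ∑ i ∈ Sᶜ, f x * w i :=
      Finset.sum_le_sum fun i hi => mul_le_mul_of_nonneg_right (hmax i hi) (hw0 i)
    rw [← Finset.mul_sum] at h1 h2
    have h3 : ∑ i ∈ S, (1 - w i) = k - ∑ i ∈ S, w i := by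
      simp [Finset.sum_sub_distrib, hS]
    rw [h3] at h1
    have h4 : ∑ i ∈ Sᶜ, f i * (1 - w i) = ∑ i ∈ Sᶜ, f i - ∑ i ∈ Sᶜ, f i * w i := by
      simp [mul_sub, Finset.sum_sub_distrib]
    rw [h4]
    nlinarith [hf x]

/-- The final expression is the squared distance from a purification to the truncated product
vector. One ε pays for the discarded mass of r, the other for the distance of square roots on the
retained blocks. -/
theorem exists_finset_truncation_le {ι Y : Type*} [Fintype ι] [Fintype Y] [DecidableEq Y]
    {q : ℕ} (hq : 0 < q) {p : ι → ℝ} {r : Y → ℝ} {m : ι → Fin q × Y → ℝ}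
    (hp : ∀ i, 0 ≤ p i) (hr : ∀ j, 0 ≤ r j) (hm : ∀ i k, 0 ≤ m i k)
    (hm1 : ∀ i, ∑ k, m i k = 1) (hm2 : ∀ k, ∑ i, m i k = 1)
    (hmarg : ∀ j, ∑ b, ∑ i, p i * m i (b, j) = r j) (hr1 : ∑ j, r j = 1) {n : ℕ}
    (hrank : Fintype.card {i // p i ≠ 0} ≤ n * q) {ε : ℝ}
    (hε : ∑ i, ∑ k, m i k * (Real.sqrt (p i) - Real.sqrt (r k.2 / q)) ^ 2 ≤ ε) :
    ∃ S : Finset Y, S.card ≤ n ∧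
      1 + ∑ k : Fin q × Y, (if k.2 ∈ S then r k.2 / q else 0)
        - 2 * ∑ k : Fin q × Y,
            (if k.2 ∈ S then Real.sqrt (r k.2 / q) * ∑ i, Real.sqrt (p i) * m i k else 0)
        ≤ 2 * ε := by
  classical
  have hq' : (0 : ℝ) < q := by exact_mod_cast hq
  obtain ⟨S, hS, htail⟩ := exists_finset_tail_le r n
  refine ⟨S, hS, ?_⟩
  let d : Fin q × Y → ℝ := fun k => ∑ i, m i k * (Real.sqrt (p i) - Real.sqrt (r k.2 / q)) ^ 2
  have hd0 : ∀ k, 0 ≤ d k := fun k =>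
    Finset.sum_nonneg fun i _ => mul_nonneg (hm i k) (sq_nonneg _)
  have hdε : ∑ j, ∑ b, d (b, j) ≤ ε := by
    rw [Finset.sum_comm' (t' := Finset.univ) (s' := fun _ => Finset.univ) (by simp)]
    rw [← Fintype.sum_prod_type (f := d), Finset.sum_comm]
    exact hε
  have hdexp : ∀ k, d k = ∑ i, p i * m i k + r k.2 / q
      - 2 * (Real.sqrt (r k.2 / q) * ∑ i, Real.sqrt (p i) * m i k) := by
    intro k
    have hs : 0 ≤ r k.2 / q := div_nonneg (hr _) hq'.le
    have : ∀ i, m i k * (Real.sqrt (p i) - Real.sqrt (r k.2 / q)) ^ 2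
        = p i * m i k + (r k.2 / q) * m i k
          - 2 * Real.sqrt (r k.2 / q) * (Real.sqrt (p i) * m i k) := by
      intro i
      have h1 := Real.sq_sqrt (hp i)
      have h2 := Real.sq_sqrt hs
      linear_combination (m i k) * h1 + (m i k) * h2
    simp only [d, this, Finset.sum_add_distrib, Finset.sum_sub_distrib, ← Finset.mul_sum, hm2]
    ring
  -- The normalised weight of block j in the support of p. These weights sum to rank / q ≤ n.
  let w : Y → ℝ := fun j => (∑ b, ∑ i, if p i ≠ 0 then m i (b, j) else 0) / q
  have hinner : ∀ k, ∑ i, (if p i ≠ 0 then m i k else 0) ≤ 1 := fun k => by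
    rw [← hm2 k]
    refine Finset.sum_le_sum fun i _ => ?_
    split_ifs
    · exact le_rfl
    · exact hm i k
  have hw0 : ∀ j, 0 ≤ w j := fun j => by
    refine div_nonneg (Finset.sum_nonneg fun b _ => Finset.sum_nonneg fun i _ => ?_) hq'.le
    split_ifs
    · exact hm _ _
    · exact le_rfl
  have hw1 : ∀ j, w j ≤ 1 := fun j => by
    rw [div_le_one hq']
    refine (Finset.sum_le_sum fun b _ => hinner (b, j)).trans ?_
    simp
  have hwn : ∑ j, w j ≤ n := by
    have h1 : ∑ j, ∑ b : Fin q, ∑ i, (if p i ≠ 0 then m i (b, j) else 0)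
        = (Fintype.card {i // p i ≠ 0} : ℝ) := by
      rw [Finset.sum_comm, ← Fintype.sum_prod_type
        (f := fun k : Fin q × Y => ∑ i, (if p i ≠ 0 then m i k else 0)), Finset.sum_comm]
      have : ∀ i, ∑ k, (if p i ≠ 0 then m i k else 0) = if p i ≠ 0 then (1 : ℝ) else 0 := by
        intro i
        split_ifs
        · exact hm1 i
        · simp
      simp only [this, Fintype.card_subtype, Finset.sum_boole]
    rw [← Finset.sum_div, h1, div_le_iff₀ hq']
    exact_mod_cast hrank
  have h1 := htail w hw0 hw1 hwn hr
  -- Mass of r outside the support of p is already paid for: where p i = 0 the summand of d is m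
  -- times r / q.
  have h2 : ∀ j, r j * (1 - w j) ≤ ∑ b, d (b, j) := by
    intro j
    have e : r j * (1 - w j)
        = ∑ b : Fin q, r j / q * (1 - ∑ i, if p i ≠ 0 then m i (b, j) else 0) := by
      rw [← Finset.mul_sum, Finset.sum_sub_distrib]
      simp only [Finset.sum_const, Finset.card_univ, Fintype.card_fin, w]
      field_simp
      simp
    rw [e]
    refine Finset.sum_le_sum fun b _ => ?_
    have e2 : 1 - ∑ i, (if p i ≠ 0 then m i (b, j) else 0)
        = ∑ i, if p i = 0 then m i (b, j) else 0 := by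
      rw [← hm2 (b, j), ← Finset.sum_sub_distrib]
      refine Finset.sum_congr rfl fun i _ => ?_
      by_cases h : p i = 0 <;> simp [h]
    rw [e2, Finset.mul_sum]
    refine Finset.sum_le_sum fun i _ => ?_
    by_cases h : p i = 0
    · simp only [h, if_true, Real.sqrt_zero, zero_sub, neg_sq]
      rw [Real.sq_sqrt (div_nonneg (hr _) hq'.le), mul_comm]
    · simp only [h, if_false, mul_zero]
      exact mul_nonneg (hm _ _) (sq_nonneg _)
  have h3 : ∑ j ∈ Sᶜ, r j ≤ ε := h1.trans ((Finset.sum_le_sum fun j _ => h2 j).trans hdε)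
  have h4 : ∑ j ∈ S, ∑ b, d (b, j) ≤ ε :=
    (Finset.sum_le_univ_sum_of_nonneg fun j => Finset.sum_nonneg fun b _ => hd0 _).trans hdε
  have hsplit : ∀ g : Fin q × Y → ℝ,
      ∑ k, (if k.2 ∈ S then g k else 0) = ∑ j ∈ S, ∑ b, g (b, j) := by
    intro g
    rw [Fintype.sum_prod_type, Finset.sum_comm, ← Finset.sum_filter_add_sum_filter_not _ (· ∈ S)]
    rw [Finset.filter_mem_eq_inter, Finset.univ_inter]
    rw [Finset.sum_eq_zero (s := Finset.univ.filter fun j => j ∉ S), add_zero]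
    · exact Finset.sum_congr rfl fun j hj => by simp [hj]
    · intro j hj
      simp [(Finset.mem_filter.mp hj).2]
  have h5 : ∑ j ∈ S, ∑ b, d (b, j) = ∑ j ∈ S, r j + ∑ j ∈ S, ∑ b : Fin q, r j / q
      - 2 * ∑ j ∈ S, ∑ b, (Real.sqrt (r j / q) * ∑ i, Real.sqrt (p i) * m i (b, j)) := by
    simp only [hdexp, Finset.sum_add_distrib, Finset.sum_sub_distrib, hmarg, Finset.mul_sum]
  rw [hsplit fun k => r k.2 / q,
    hsplit fun k => Real.sqrt (r k.2 / q) * ∑ i, Real.sqrt (p i) * m i k]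
  have h6 := Finset.sum_add_sum_compl S r
  linarith

/-- The Gram matrix `trB (Mᴴ M)` of `M`, read as a matrix from `Y` to `A × Fin q`. -/
def reducedGram {A Y : Type*} [Fintype A] {q : ℕ} (M : Matrix A (Fin q × Y) ℂ) : Matrix Y Y ℂ :=
  ∑ b, (M.submatrix id (Prod.mk b))ᴴ * M.submatrix id (Prod.mk b)

theorem reducedGram_apply {A Y : Type*} [Fintype A] {q : ℕ} (M : Matrix A (Fin q × Y) ℂ)
    (y y' : Y) :
    reducedGram M y y' = ∑ b, (Mᴴ * M) (b, y) (b, y') := by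
  simp [reducedGram, Matrix.sum_apply, mul_apply]

theorem isHermitian_reducedGram {A Y : Type*} [Fintype A] {q : ℕ} (M : Matrix A (Fin q × Y) ℂ) :
    (reducedGram M).IsHermitian := by
  rw [IsHermitian, reducedGram, conjTranspose_sum]
  simp [conjTranspose_mul]

theorem reducedGram_mul_kronecker {A Y : Type*} [Fintype A] [Fintype Y] {q : ℕ}
    (M : Matrix A (Fin q × Y) ℂ) (W : Matrix Y Y ℂ) :
    reducedGram (M * ((1 : Matrix (Fin q) (Fin q) ℂ) ⊗ₖ W)) = Wᴴ * reducedGram M * W := by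
  have h : ∀ b, (M * ((1 : Matrix (Fin q) (Fin q) ℂ) ⊗ₖ W)).submatrix id (Prod.mk b)
      = M.submatrix id (Prod.mk b) * W := by
    intro b
    ext a j
    simp [mul_apply, Fintype.sum_prod_type, one_apply]
  simp only [reducedGram, h, conjTranspose_mul, Matrix.mul_sum, Matrix.sum_mul, Matrix.mul_assoc]

theorem mul_kronecker_mul_conjTranspose {A Y : Type*} [Fintype Y] [DecidableEq Y] {q : ℕ}
    (M : Matrix A (Fin q × Y) ℂ) {W : Matrix Y Y ℂ}
    (hW : W * Wᴴ = 1) :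
    (M * ((1 : Matrix (Fin q) (Fin q) ℂ) ⊗ₖ W)) * (M * ((1 : Matrix (Fin q) (Fin q) ℂ) ⊗ₖ W))ᴴ
      = M * Mᴴ := by
  rw [conjTranspose_mul, conjTranspose_kronecker, Matrix.mul_assoc, ← Matrix.mul_assoc _ _ Mᴴ,
    ← mul_kronecker_mul, hW]
  simp

/-! ### Subadditivity with a qudit, and its defect -/

section Spectral

variable {A Y : Type*} [Fintype A] [Fintype Y] [DecidableEq Y] {q : ℕ}

theorem sum_normSq_row {n : Type*} [Fintype n] [DecidableEq n] {U : Matrix n n ℂ}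
    (hU : U * Uᴴ = 1) (k : n) : ∑ i, ‖U k i‖ ^ 2 = 1 := by
  have h := congrFun (congrFun hU k) k
  simp only [mul_apply, conjTranspose_apply, one_apply_eq, Complex.star_def, Complex.mul_conj'] at h
  exact_mod_cast h

theorem sum_normSq_col {n : Type*} [Fintype n] [DecidableEq n] {U : Matrix n n ℂ}
    (hU : Uᴴ * U = 1) (i : n) : ∑ k, ‖U k i‖ ^ 2 = 1 := by
  have h := congrFun (congrFun hU i) i
  simp only [mul_apply, conjTranspose_apply, one_apply_eq, Complex.star_def, Complex.conj_mul'] at h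
  exact_mod_cast h

theorem diag_mul_diagonal_mul_conjTranspose {n : Type*} [Fintype n] [DecidableEq n]
    (U : Matrix n n ℂ) (p : n → ℝ) (k : n) :
    (U * diagonal (fun i => (p i : ℂ)) * Uᴴ) k k = ((∑ i, p i * ‖U k i‖ ^ 2 : ℝ) : ℂ) := by
  rw [mul_apply]
  push_cast
  refine Finset.sum_congr rfl fun i _ => ?_
  rw [mul_diagonal, conjTranspose_apply, Complex.star_def, ← Complex.mul_conj']
  ring

theorem marginal_of_reducedGram_eq_diagonal {M : Matrix A (Fin q × Y) ℂ} {r : Y → ℝ}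
    (hr : reducedGram M = diagonal fun j => (r j : ℂ))
    {U : Matrix (Fin q × Y) (Fin q × Y) ℂ} {p : Fin q × Y → ℝ}
    (hU : Mᴴ * M = U * diagonal (fun i => (p i : ℂ)) * Uᴴ) (j : Y) :
    ∑ b, ∑ i, p i * ‖U (b, j) i‖ ^ 2 = r j := by
  have h := reducedGram_apply M j j
  simp only [hr, hU, diag_mul_diagonal_mul_conjTranspose, diagonal_apply_eq] at h
  exact_mod_cast h.symm

theorem sum_eq_one_of_reducedGram_eq_diagonal {M : Matrix A (Fin q × Y) ℂ} {r : Y → ℝ}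
    (hr : reducedGram M = diagonal fun j => (r j : ℂ)) (hM : (Mᴴ * M).trace = 1) :
    ∑ j, r j = 1 := by
  have h : (Mᴴ * M).trace = ∑ j, reducedGram M j j := by
    simp only [reducedGram_apply, trace, Fintype.sum_prod_type, diag_apply]
    rw [Finset.sum_comm]
  simp only [hM, hr, diagonal_apply_eq] at h
  exact_mod_cast h.symm

/-- The right side is the relative entropy of MᴴM with respect to 1/q ⊗ diag r. -/
theorem sum_sq_sqrt_sub_sqrt_le_entropy (hq : 0 < q) {M : Matrix A (Fin q × Y) ℂ} {r : Y → ℝ}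
    (hr : reducedGram M = diagonal fun j => (r j : ℂ)) (hM : (Mᴴ * M).trace = 1)
    {U : Matrix (Fin q × Y) (Fin q × Y) ℂ} {p : Fin q × Y → ℝ} (hp : ∀ i, 0 ≤ p i)
    (hU1 : Uᴴ * U = 1) (hU2 : U * Uᴴ = 1)
    (hU : Mᴴ * M = U * diagonal (fun i => (p i : ℂ)) * Uᴴ) :
    ∑ i, ∑ k, ‖U k i‖ ^ 2 * (Real.sqrt (p i) - Real.sqrt (r k.2 / q)) ^ 2
      ≤ Real.log q + ∑ j, Real.negMulLog (r j) - ∑ i, Real.negMulLog (p i) := by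
  have hq' : (0 : ℝ) < q := by exact_mod_cast hq
  have hmarg := marginal_of_reducedGram_eq_diagonal hr hU
  have hr1 := sum_eq_one_of_reducedGram_eq_diagonal hr hM
  have hnn : ∀ b j i, 0 ≤ p i * ‖U (b, j) i‖ ^ 2 := fun b j i => mul_nonneg (hp i) (sq_nonneg _)
  have hr0 : ∀ j, 0 ≤ r j := fun j => by
    rw [← hmarg]
    exact Finset.sum_nonneg fun b _ => Finset.sum_nonneg fun i _ => hnn b j i
  have hp1 : ∑ i, p i = 1 := by
    rw [← hr1]
    simp only [← hmarg]
    rw [Finset.sum_comm, ← Fintype.sum_prod_type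
      (f := fun k : Fin q × Y => ∑ i, p i * ‖U k i‖ ^ 2), Finset.sum_comm]
    simp only [← Finset.mul_sum, sum_normSq_col hU1, mul_one]
  have hs1 : ∑ k : Fin q × Y, r k.2 / q = 1 := by
    rw [Fintype.sum_prod_type]
    simp only [← Finset.sum_div, hr1, Finset.sum_const, Finset.card_univ, Fintype.card_fin]
    simp [hq'.ne']
  have hmain := sum_mul_sq_sqrt_sub_sqrt_le (p := p) (s := fun k : Fin q × Y => r k.2 / q)
    (m := fun i k => ‖U k i‖ ^ 2) hp (fun k => div_nonneg (hr0 k.2) hq'.le)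
    (fun i k => sq_nonneg _) (sum_normSq_col hU1) (sum_normSq_row hU2) (hp1.trans hs1.symm) ?_
  · refine hmain.trans (le_of_eq ?_)
    have e1 : ∑ k : Fin q × Y, (∑ i, p i * ‖U k i‖ ^ 2) * Real.log (r k.2 / q)
        = ∑ j, r j * Real.log (r j / q) := by
      rw [Fintype.sum_prod_type, Finset.sum_comm]
      simp only [← Finset.sum_mul, hmarg]
    have e2 : ∀ j, r j * Real.log (r j / q) = r j * Real.log (r j) - r j * Real.log q := by
      intro j
      by_cases h : r j = 0
      · simp [h]
      · rw [Real.log_div h hq'.ne', mul_sub]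
    rw [e1]
    simp only [e2, Finset.sum_sub_distrib, ← Finset.sum_mul, hr1, Real.negMulLog, neg_mul,
      Finset.sum_neg_distrib]
    ring
  -- Support condition: a vanishing marginal r j is a sum of nonnegative terms, so each term
  -- vanishes.
  · rintro i ⟨b, j⟩ h0
    have hrj : r j = 0 := by simpa [hq'.ne'] using h0
    have h1 := (hmarg j).trans hrj
    rw [Finset.sum_eq_zero_iff_of_nonneg fun b _ => Finset.sum_nonneg fun i _ => hnn b j i] at h1
    have h2 := h1 b (Finset.mem_univ _)
    rw [Finset.sum_eq_zero_iff_of_nonneg fun i _ => hnn b j i] at h2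
    exact h2 i (Finset.mem_univ _)

/-- A change of basis on `Y` alone commutes with the partial trace over the qudit, so the marginal
may be taken diagonal. -/
theorem exists_kronecker_diagonalization (M : Matrix A (Fin q × Y) ℂ) :
    ∃ (W : Matrix Y Y ℂ) (r : Y → ℝ), Wᴴ * W = 1 ∧ W * Wᴴ = 1 ∧
      entropy (reducedGram M) = ∑ j, Real.negMulLog (r j) ∧
      reducedGram (M * ((1 : Matrix (Fin q) (Fin q) ℂ) ⊗ₖ W)) = diagonal fun j => (r j : ℂ) := by
  have hH := isHermitian_reducedGram M
  obtain ⟨W, h1, h2, h3⟩ := exists_unitary_diagonalization hH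
  refine ⟨W, hH.eigenvalues, h1, h2, entropy_of_isHermitian hH, ?_⟩
  rw [reducedGram_mul_kronecker]
  conv_lhs => rw [h3]
  simp only [Matrix.mul_assoc, h1, Matrix.mul_one]
  rw [← Matrix.mul_assoc, h1, Matrix.one_mul]

theorem trace_gram_mul_kronecker {M : Matrix A (Fin q × Y) ℂ} {W : Matrix Y Y ℂ}
    (hW : W * Wᴴ = 1) (hM : (Mᴴ * M).trace = 1) :
    ((M * ((1 : Matrix (Fin q) (Fin q) ℂ) ⊗ₖ W))ᴴ *
      (M * ((1 : Matrix (Fin q) (Fin q) ℂ) ⊗ₖ W))).trace = 1 := by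
  rw [trace_mul_comm, mul_kronecker_mul_conjTranspose M hW, trace_mul_comm, hM]

/-- Subadditivity of the entropy, with one factor a qudit. -/
theorem entropy_le_log_add_entropy_reducedGram [DecidableEq A] (hq : 0 < q)
    {M : Matrix A (Fin q × Y) ℂ}
    (hM : (Mᴴ * M).trace = 1) :
    entropy (M * Mᴴ) ≤ Real.log q + entropy (reducedGram M) := by
  obtain ⟨W, r, hW1, hW2, hent, hdiag⟩ := exists_kronecker_diagonalization M
  rw [← mul_kronecker_mul_conjTranspose M hW2, entropy_mul_conjTranspose_self, hent]
  have hM' := trace_gram_mul_kronecker hW2 hM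
  set M' := M * ((1 : Matrix (Fin q) (Fin q) ℂ) ⊗ₖ W)
  have hH := isHermitian_conjTranspose_mul_self M'
  obtain ⟨U, hU1, hU2, hU⟩ := exists_unitary_diagonalization hH
  have h := sum_sq_sqrt_sub_sqrt_le_entropy hq hdiag hM'
    (posSemidef_conjTranspose_mul_self M').eigenvalues_nonneg hU1 hU2 hU
  rw [entropy_of_isHermitian hH]
  have h0 : 0 ≤ ∑ i, ∑ k, ‖U k i‖ ^ 2 *
      (Real.sqrt (hH.eigenvalues i) - Real.sqrt (r k.2 / q)) ^ 2 :=
    Finset.sum_nonneg fun i _ => Finset.sum_nonneg fun k _ => mul_nonneg (sq_nonneg _) (sq_nonneg _)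
  linarith

end Spectral

/-- The squared Hilbert-Schmidt norm. -/
noncomputable def hsSq {m n : Type*} [Fintype m] [Fintype n] (X : Matrix m n ℂ) : ℝ :=
  ∑ i, ∑ j, ‖X i j‖ ^ 2

/-! ### Hilbert-Schmidt distance -/

section HilbertSchmidt

variable {m n : Type*} [Fintype m] [Fintype n]

theorem ofReal_hsSq (X : Matrix m n ℂ) : ((hsSq X : ℝ) : ℂ) = (X * Xᴴ).trace := by
  simp only [hsSq, trace, diag_apply, mul_apply, conjTranspose_apply, Complex.star_def,
    Complex.mul_conj']
  push_cast
  rfl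

theorem hsSq_sub (X Y : Matrix m n ℂ) :
    hsSq (X - Y) = hsSq X + hsSq Y - 2 * (X * Yᴴ).trace.re := by
  simp only [hsSq, trace, diag_apply, mul_apply, conjTranspose_apply, Complex.re_sum,
    Finset.mul_sum, ← Finset.sum_add_distrib, ← Finset.sum_sub_distrib]
  refine Finset.sum_congr rfl fun i _ => Finset.sum_congr rfl fun j _ => ?_
  simp only [Matrix.sub_apply, ← Complex.normSq_eq_norm_sq, Complex.normSq_sub, Complex.star_def]

theorem hsSq_mul_of_isometry {l : Type*} [Fintype l] [DecidableEq m] {V : Matrix l m ℂ}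
    (hV : Vᴴ * V = 1) (X : Matrix m n ℂ) : hsSq (V * X) = hsSq X := by
  have h : ((hsSq (V * X) : ℝ) : ℂ) = (hsSq X : ℝ) := by
    rw [ofReal_hsSq, ofReal_hsSq, conjTranspose_mul, trace_mul_comm, Matrix.mul_assoc,
      ← Matrix.mul_assoc Vᴴ, hV, Matrix.one_mul, trace_mul_comm]
  exact_mod_cast h

theorem hsSq_mul_of_coisometry {l : Type*} [Fintype l] [DecidableEq n] {W : Matrix n l ℂ}
    (hW : W * Wᴴ = 1) (X : Matrix m n ℂ) : hsSq (X * W) = hsSq X := by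
  have h : ((hsSq (X * W) : ℝ) : ℂ) = (hsSq X : ℝ) := by
    rw [ofReal_hsSq, ofReal_hsSq, conjTranspose_mul, Matrix.mul_assoc, ← Matrix.mul_assoc W, hW,
      Matrix.one_mul]
  exact_mod_cast h

end HilbertSchmidt

/-- The amplitudes of `|Φ⟩ ⊗ |N⟩`, where `Φ` is the canonical maximally entangled state of two
qudits. -/
noncomputable def entangledProduct {A₁ Y : Type*} {q : ℕ} (N : Matrix A₁ Y ℂ) :
    Matrix (A₁ × Fin q) (Fin q × Y) ℂ :=
  of fun x k => if x.2 = k.1 then ((Real.sqrt q)⁻¹ : ℝ) * N x.1 k.2 else 0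

theorem entangledProduct_mul_kronecker {A₁ Y Y' : Type*} [Fintype Y] {q : ℕ} (N : Matrix A₁ Y ℂ)
    (W : Matrix Y Y' ℂ) :
    (entangledProduct N : Matrix (A₁ × Fin q) (Fin q × Y) ℂ) *
      ((1 : Matrix (Fin q) (Fin q) ℂ) ⊗ₖ W) = entangledProduct (N * W) := by
  ext x k
  simp only [entangledProduct, mul_apply, of_apply, kroneckerMap_apply, Fintype.sum_prod_type,
    one_apply]
  by_cases h : x.2 = k.1
  · simp [h, Finset.mul_sum, mul_assoc]
  · simp [h]

/-! ### Extracting a maximally entangled qudit on one side -/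

section Side

variable {A A₁ Y : Type*} [Fintype A] [Fintype A₁] [Fintype Y] [DecidableEq A] [DecidableEq A₁]
  [DecidableEq Y] {q : ℕ}

/-- Uhlmann's argument: minimising the distance over V means maximising Re tr(V G), and the
contraction `E * Wᴴ` already achieves the overlap of the square roots. `exists_isometry_re_trace_le`
supplies an isometry that is no worse. -/
theorem exists_isometry_near_of_diagonal (hq : 0 < q)
    (hcard : Fintype.card A ≤ Fintype.card (A₁ × Fin q)) {M : Matrix A (Fin q × Y) ℂ} {r : Y → ℝ}
    (hr : reducedGram M = diagonal fun j => (r j : ℂ)) (hM : (Mᴴ * M).trace = 1) {ε : ℝ}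
    (hε : Real.log q + ∑ j, Real.negMulLog (r j) - entropy (Mᴴ * M) ≤ ε) :
    ∃ (V : Matrix (A₁ × Fin q) A ℂ) (N : Matrix A₁ Y ℂ), Vᴴ * V = 1 ∧
      hsSq (V * M - entangledProduct N) ≤ 2 * ε := by
  classical
  have hq' : (0 : ℝ) < q := by exact_mod_cast hq
  have hH := isHermitian_conjTranspose_mul_self M
  obtain ⟨U, hU1, hU2, hU⟩ := exists_unitary_diagonalization hH
  have hp := (posSemidef_conjTranspose_mul_self M).eigenvalues_nonneg
  rw [entropy_of_isHermitian hH] at hε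
  have hrk : Fintype.card {i // hH.eigenvalues i ≠ 0} ≤ Fintype.card A₁ * q := by
    rw [← hH.rank_eq_card_non_zero_eigs, rank_conjTranspose_mul_self]
    refine (rank_le_card_height M).trans (hcard.trans (le_of_eq ?_))
    simp
  set p := hH.eigenvalues
  have hδ := (sum_sq_sqrt_sub_sqrt_le_entropy hq hr hM hp hU1 hU2 hU).trans hε
  have hmarg := marginal_of_reducedGram_eq_diagonal hr hU
  have hr0 : ∀ j, 0 ≤ r j := fun j => by
    rw [← hmarg]
    exact Finset.sum_nonneg fun b _ => Finset.sum_nonneg fun i _ => mul_nonneg (hp i) (sq_nonneg _)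
  obtain ⟨S, hS, hSle⟩ := exists_finset_truncation_le hq hp hr0 (m := fun i k => ‖U k i‖ ^ 2)
    (fun i k => sq_nonneg _) (sum_normSq_col hU1) (sum_normSq_row hU2) hmarg
    (sum_eq_one_of_reducedGram_eq_diagonal hr hM) hrk hδ
  obtain ⟨f⟩ := Function.Embedding.nonempty_of_card_le
    (show Fintype.card S ≤ Fintype.card A₁ by simpa using hS)
  -- Partial isometry that places the retained eigenvectors of the marginal in `A₁` and copies the
  -- qudit label to `A₂`.
  let E : Matrix (A₁ × Fin q) (Fin q × Y) ℂ :=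
    of fun x k => if h : k.2 ∈ S then (if x = (f ⟨k.2, h⟩, k.1) then 1 else 0) else 0
  let s : Fin q × Y → ℂ := fun k => ((Real.sqrt (r k.2 / q) : ℝ) : ℂ)
  have hE : Eᴴ * E = diagonal fun k => if k.2 ∈ S then (1 : ℂ) else 0 := by
    ext k k'
    simp only [mul_apply, conjTranspose_apply, E, of_apply, diagonal_apply]
    by_cases h : k.2 ∈ S
    · by_cases h' : k'.2 ∈ S
      · have : (f ⟨k.2, h⟩, k.1) = (f ⟨k'.2, h'⟩, k'.1) ↔ k = k' := by
          rw [Prod.mk.injEq, f.injective.eq_iff, Subtype.mk.injEq, and_comm, ← Prod.ext_iff]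
        simp [h, h', ← this, @eq_comm _ k'.2, @eq_comm _ k'.1]
      · have : k ≠ k' := fun hk => h' (hk ▸ h)
        simp [h', this]
    · simp [h]
  let N : Matrix A₁ Y ℂ :=
    of fun a j => if h : j ∈ S then (if a = f ⟨j, h⟩ then ((Real.sqrt (r j) : ℝ) : ℂ) else 0) else 0
  have hN : entangledProduct N = E * diagonal s := by
    ext x k
    simp only [entangledProduct, N, E, s, of_apply, mul_diagonal, Prod.ext_iff]
    rw [Real.sqrt_div (hr0 k.2)]
    by_cases h : k.2 ∈ S
    · by_cases h1 : x.1 = f ⟨k.2, h⟩ <;> by_cases h2 : x.2 = k.1 <;> simp [h, h1, h2]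
      ring
    · simp [h]
  -- Pseudo-inverse of √p, thanks to 0⁻¹ = 0.
  let P : Matrix (Fin q × Y) (Fin q × Y) ℂ := diagonal fun i => (((Real.sqrt (p i))⁻¹ : ℝ) : ℂ)
  have hPP : P * (diagonal fun i => (p i : ℂ)) = diagonal fun i => ((Real.sqrt (p i) : ℝ) : ℂ) := by
    simp only [P, diagonal_mul_diagonal]
    congr 1
    ext i
    by_cases h : p i = 0
    · simp [h]
    · have h1 : Real.sqrt (p i) ≠ 0 := (Real.sqrt_pos.mpr (lt_of_le_of_ne (hp i) (Ne.symm h))).ne'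
      have h2 : (Real.sqrt (p i))⁻¹ * p i = Real.sqrt (p i) := by
        rw [inv_mul_eq_iff_eq_mul₀ h1, Real.mul_self_sqrt (hp i)]
      exact_mod_cast h2
  have hPPP : (P * (diagonal fun i => (p i : ℂ)) * P) * (P * (diagonal fun i => (p i : ℂ)) * P)
      = P * (diagonal fun i => (p i : ℂ)) * P := by
    rw [hPP]
    simp only [P, diagonal_mul_diagonal]
    congr 1
    ext i
    by_cases h : p i = 0
    · simp [h]
    · have h1 : Real.sqrt (p i) ≠ 0 := (Real.sqrt_pos.mpr (lt_of_le_of_ne (hp i) (Ne.symm h))).ne'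
      have h2 : (Real.sqrt (p i)) * (Real.sqrt (p i))⁻¹ = 1 := mul_inv_cancel₀ h1
      have h3 : ((Real.sqrt (p i) : ℝ) : ℂ) * (((Real.sqrt (p i))⁻¹ : ℝ) : ℂ) = 1 := by
        exact_mod_cast h2
      rw [h3, one_mul]
  have hPH : Pᴴ = P := by
    simp only [P, diagonal_conjTranspose]
    congr 1
    ext i
    simp
  -- The partial isometry of the polar decomposition M = W √(MᴴM).
  let W : Matrix A (Fin q × Y) ℂ := M * U * P * Uᴴ
  have hWM : Wᴴ * M = U * (diagonal fun i => ((Real.sqrt (p i) : ℝ) : ℂ)) * Uᴴ := by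
    simp only [W, conjTranspose_mul, conjTranspose_conjTranspose, hPH]
    calc U * (P * (Uᴴ * Mᴴ)) * M = U * P * Uᴴ * (Mᴴ * M) := by simp only [Matrix.mul_assoc]
      _ = U * P * (Uᴴ * U) * (diagonal fun i => (p i : ℂ)) * Uᴴ := by
          rw [hU]; simp only [Matrix.mul_assoc]
      _ = U * (P * (diagonal fun i => (p i : ℂ))) * Uᴴ := by
          rw [hU1]; simp only [Matrix.mul_assoc, Matrix.one_mul]
      _ = _ := by rw [hPP]
  have hWW : Wᴴ * W = U * (P * (diagonal fun i => (p i : ℂ)) * P) * Uᴴ := by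
    calc Wᴴ * W = Wᴴ * M * U * P * Uᴴ := by simp only [W, Matrix.mul_assoc]
      _ = U * (P * (diagonal fun i => (p i : ℂ))) * (Uᴴ * U) * P * Uᴴ := by
          rw [hWM, hPP]; simp only [Matrix.mul_assoc]
      _ = _ := by rw [hU1]; simp only [Matrix.mul_assoc, Matrix.one_mul]
  have hWn : ‖Wᴴ‖ ≤ 1 := by
    rw [l2_opNorm_conjTranspose]
    apply l2_opNorm_le_one_of_idempotent
    rw [hWW]
    generalize hX : P * (diagonal fun i => (p i : ℂ)) * P = X at hPPP
    calc U * X * Uᴴ * (U * X * Uᴴ) = U * X * (Uᴴ * U) * X * Uᴴ := by simp only [Matrix.mul_assoc]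
      _ = U * (X * X) * Uᴴ := by rw [hU1]; simp only [Matrix.mul_assoc, Matrix.one_mul]
      _ = _ := by rw [hPPP]
  have hEn : ‖E‖ ≤ 1 := l2_opNorm_le_one_of_idempotent E (by
    rw [hE, diagonal_mul_diagonal]
    congr 1
    ext k
    simp)
  have hK : ‖E * Wᴴ‖ ≤ 1 := by
    calc ‖E * Wᴴ‖ ≤ ‖E‖ * ‖Wᴴ‖ := l2_opNorm_mul _ _
      _ ≤ 1 * 1 := by gcongr
      _ = 1 := one_mul 1
  obtain ⟨V, hV, hVmax⟩ := exists_isometry_re_trace_le hcard (M * (E * diagonal s)ᴴ)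
  refine ⟨V, N, hV, ?_⟩
  have hsH : (diagonal s)ᴴ = diagonal s := by
    simp only [s, diagonal_conjTranspose]
    congr 1
    ext i
    simp
  have htr : (E * Wᴴ * (M * (E * diagonal s)ᴴ)).trace.re = ∑ k : Fin q × Y,
      (if k.2 ∈ S then Real.sqrt (r k.2 / q) * ∑ i, Real.sqrt (p i) * ‖U k i‖ ^ 2 else 0) := by
    have h1 : (E * Wᴴ * (M * (E * diagonal s)ᴴ)).trace
        = ((U * (diagonal fun i => ((Real.sqrt (p i) : ℝ) : ℂ)) * Uᴴ) *
          (diagonal s * diagonal fun k : Fin q × Y => if k.2 ∈ S then (1 : ℂ) else 0)).trace := by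
      rw [← hWM, ← hE, conjTranspose_mul E, hsH, Matrix.mul_assoc, trace_mul_comm]
      simp only [Matrix.mul_assoc]
    rw [h1, diagonal_mul_diagonal, trace, Complex.re_sum]
    refine Finset.sum_congr rfl fun k _ => ?_
    rw [diag_apply, mul_diagonal, diag_mul_diagonal_mul_conjTranspose]
    by_cases h : k.2 ∈ S
    · simp only [h, if_true, mul_one, s, ← Complex.ofReal_mul, Complex.ofReal_re]
      exact mul_comm _ _
    · simp [h]
  have hNsq : hsSq (E * diagonal s) = ∑ k : Fin q × Y, (if k.2 ∈ S then r k.2 / q else 0) := by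
    have h1 : ((hsSq (E * diagonal s) : ℝ) : ℂ)
        = ((∑ k : Fin q × Y, (if k.2 ∈ S then r k.2 / q else 0) : ℝ) : ℂ) := by
      rw [ofReal_hsSq, trace_mul_comm, conjTranspose_mul, hsH, Matrix.mul_assoc,
        ← Matrix.mul_assoc Eᴴ, hE, diagonal_mul_diagonal, diagonal_mul_diagonal, trace_diagonal,
        Complex.ofReal_sum]
      refine Finset.sum_congr rfl fun k _ => ?_
      by_cases h : k.2 ∈ S
      · simp only [h, if_true, one_mul, s, ← Complex.ofReal_mul,
          Real.mul_self_sqrt (div_nonneg (hr0 k.2) hq'.le)]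
      · simp [h]
    exact_mod_cast h1
  have hMsq : hsSq (V * M) = 1 := by
    rw [hsSq_mul_of_isometry hV]
    have h1 : ((hsSq M : ℝ) : ℂ) = 1 := by rw [ofReal_hsSq, trace_mul_comm, hM]
    exact_mod_cast h1
  have hmax := hVmax _ hK
  rw [htr] at hmax
  rw [hN, hsSq_sub, hMsq, hNsq, Matrix.mul_assoc]
  linarith

theorem exists_isometry_near_entangledProduct (hq : 0 < q)
    (hcard : Fintype.card A ≤ Fintype.card (A₁ × Fin q)) {M : Matrix A (Fin q × Y) ℂ}
    (hM : (Mᴴ * M).trace = 1) {ε : ℝ}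
    (hε : Real.log q + entropy (reducedGram M) - entropy (M * Mᴴ) ≤ ε) :
    ∃ (V : Matrix (A₁ × Fin q) A ℂ) (N : Matrix A₁ Y ℂ), Vᴴ * V = 1 ∧
      hsSq (V * M - entangledProduct N) ≤ 2 * ε := by
  obtain ⟨W, r, hW1, hW2, hent, hdiag⟩ := exists_kronecker_diagonalization M
  rw [← mul_kronecker_mul_conjTranspose M hW2, entropy_mul_conjTranspose_self, hent] at hε
  obtain ⟨V, N, hV, h⟩ := exists_isometry_near_of_diagonal hq hcard hdiag
    (trace_gram_mul_kronecker hW2 hM) hε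
  -- The change of basis on `Y` is undone in N; it does not touch the maximally entangled factor.
  refine ⟨V, N * Wᴴ, hV, le_of_eq_of_le ?_ h⟩
  have hk : ((1 : Matrix (Fin q) (Fin q) ℂ) ⊗ₖ W) * ((1 : Matrix (Fin q) (Fin q) ℂ) ⊗ₖ W)ᴴ = 1 := by
    rw [conjTranspose_kronecker, ← mul_kronecker_mul, hW2]
    simp
  rw [← hsSq_mul_of_coisometry hk (V * M - _), Matrix.sub_mul, Matrix.mul_assoc,
    entangledProduct_mul_kronecker, Matrix.mul_assoc N, hW1, Matrix.mul_one]

end Side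

/-! ### From entropy growth to the defect of subadditivity -/

section Growth

variable {A A₁ Y : Type*} [Fintype A] [Fintype A₁] [Fintype Y] [DecidableEq A] [DecidableEq A₁]
  [DecidableEq Y] {q : ℕ}

/-- Regrouping the amplitudes with `Y` as row system interchanges the two marginals, up to
transposition. The claim is then subadditivity again. -/
theorem entropy_reducedGram_le_log_add (hq : 0 < q) {M : Matrix A (Fin q × Y) ℂ}
    (hM : (Mᴴ * M).trace = 1) :
    entropy (reducedGram M) ≤ Real.log q + entropy (M * Mᴴ) := by
  let T : Matrix Y (Fin q × A) ℂ := of fun y k => M k.2 (k.1, y)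
  have h1 : T * Tᴴ = (reducedGram M)ᵀ := by
    ext y y'
    simp only [T, mul_apply, conjTranspose_apply, of_apply, transpose_apply, reducedGram_apply,
      Fintype.sum_prod_type, mul_comm]
  have h2 : reducedGram T = (M * Mᴴ)ᵀ := by
    ext a a'
    simp only [T, mul_apply, conjTranspose_apply, of_apply, transpose_apply, reducedGram_apply,
      Fintype.sum_prod_type, mul_comm]
  have h3 : (Tᴴ * T).trace = 1 := by
    rw [trace_mul_comm, h1, trace_transpose, ← hM]
    simp only [trace, diag_apply, reducedGram_apply, Fintype.sum_prod_type]
    rw [Finset.sum_comm]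
  have h := entropy_le_log_add_entropy_reducedGram hq h3
  rwa [h1, h2, entropy_transpose (isHermitian_reducedGram M),
    entropy_transpose (isHermitian_mul_conjTranspose_self M)] at h

theorem exists_isometry_near_of_entropy_growth (hq : 0 < q)
    (hcard : Fintype.card A ≤ Fintype.card (A₁ × Fin q)) {M M' : Matrix A (Fin q × Y) ℂ}
    (hMM' : M' * M'ᴴ = M * Mᴴ) (hM : (Mᴴ * M).trace = 1) {ε : ℝ}
    (hε : entropy (reducedGram M') - entropy (reducedGram M) = 2 * Real.log q - ε) :
    ∃ (V : Matrix (A₁ × Fin q) A ℂ) (N : Matrix A₁ Y ℂ), Vᴴ * V = 1 ∧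
      hsSq (V * M - entangledProduct N) ≤ 2 * ε := by
  have hM' : (M'ᴴ * M').trace = 1 := by rw [trace_mul_comm, hMM', trace_mul_comm, hM]
  have h := entropy_reducedGram_le_log_add hq hM'
  rw [hMM'] at h
  exact exists_isometry_near_entangledProduct hq hcard hM (by linarith)

end Growth

/-! ### Merging the two one-sided estimates -/

section Combine

variable {m n : Type*} [Fintype m] [Fintype n]

theorem normSq_add_le (x y : ℂ) : ‖x + y‖ ^ 2 ≤ 2 * ‖x‖ ^ 2 + 2 * ‖y‖ ^ 2 := by
  have h := pow_le_pow_left₀ (norm_nonneg _) (norm_add_le x y) 2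
  nlinarith [sq_nonneg (‖x‖ - ‖y‖)]

theorem hsSq_add_le (X Y : Matrix m n ℂ) : hsSq (X + Y) ≤ 2 * hsSq X + 2 * hsSq Y := by
  simp only [hsSq, Finset.mul_sum, ← Finset.sum_add_distrib]
  exact Finset.sum_le_sum fun i _ => Finset.sum_le_sum fun j _ => normSq_add_le _ _

theorem hsSq_neg (X : Matrix m n ℂ) : hsSq (-X) = hsSq X := by
  simp [hsSq]

variable {A₁ Y : Type*} {q : ℕ}

theorem hsSq_entangledProduct [Fintype A₁] [Fintype Y] (hq : 0 < q) (N : Matrix A₁ Y ℂ) :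
    hsSq (entangledProduct N : Matrix (A₁ × Fin q) (Fin q × Y) ℂ) = hsSq N := by
  have hq' : (0 : ℝ) < q := by exact_mod_cast hq
  simp only [hsSq, entangledProduct, of_apply, Fintype.sum_prod_type]
  refine Finset.sum_congr rfl fun a _ => ?_
  have : ∀ b b' : Fin q, ∑ y, ‖if b = b' then ((Real.sqrt q)⁻¹ : ℝ) * N a y else 0‖ ^ 2
      = if b = b' then (q : ℝ)⁻¹ * ∑ y, ‖N a y‖ ^ 2 else 0 := by
    intro b b'
    split_ifs
    · rw [Finset.mul_sum]
      refine Finset.sum_congr rfl fun y _ => ?_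
      rw [norm_mul, mul_pow, Complex.norm_real, Real.norm_eq_abs, sq_abs, inv_pow,
        Real.sq_sqrt hq'.le]
    · simp
  simp only [this, Finset.sum_ite_eq, Finset.mem_univ, if_true, Finset.sum_const, Finset.card_univ,
    Fintype.card_fin, nsmul_eq_mul]
  rw [← mul_assoc, mul_inv_cancel₀ hq'.ne', one_mul]

/-- The partial inner product of `Z` with the canonical maximally entangled state. -/
noncomputable def entangledContraction (Z : Matrix (A₁ × Fin q) (Fin q × Y) ℂ) : Matrix A₁ Y ℂ :=
  of fun a y => ∑ b, ((Real.sqrt q)⁻¹ : ℝ) * Z (a, b) (b, y)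

theorem entangledContraction_sub (Z Z' : Matrix (A₁ × Fin q) (Fin q × Y) ℂ) :
    entangledContraction (Z - Z') = entangledContraction Z - entangledContraction Z' := by
  ext a y
  simp [entangledContraction, mul_sub, Finset.sum_sub_distrib]

theorem entangledProduct_sub (N N' : Matrix A₁ Y ℂ) :
    (entangledProduct (N - N') : Matrix (A₁ × Fin q) (Fin q × Y) ℂ)
      = entangledProduct N - entangledProduct N' := by
  ext x k
  by_cases h : x.2 = k.1 <;> simp [entangledProduct, h, mul_sub]

theorem entangledContraction_entangledProduct (hq : 0 < q) (N : Matrix A₁ Y ℂ) :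
    entangledContraction (entangledProduct N : Matrix (A₁ × Fin q) (Fin q × Y) ℂ) = N := by
  have hq' : (0 : ℝ) < q := by exact_mod_cast hq
  ext a y
  simp only [entangledContraction, entangledProduct, of_apply, if_true, Finset.sum_const,
    Finset.card_univ, Fintype.card_fin, nsmul_eq_mul, ← mul_assoc]
  have h : (q : ℝ) * (Real.sqrt q)⁻¹ * (Real.sqrt q)⁻¹ = 1 := by
    rw [mul_assoc, ← mul_inv, Real.mul_self_sqrt hq'.le, mul_inv_cancel₀ hq'.ne']
  have h' : (q : ℂ) * ((Real.sqrt q)⁻¹ : ℝ) * ((Real.sqrt q)⁻¹ : ℝ) = 1 := by exact_mod_cast h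
  rw [h', one_mul]

theorem hsSq_entangledContraction_le [Fintype A₁] [Fintype Y] (hq : 0 < q)
    (Z : Matrix (A₁ × Fin q) (Fin q × Y) ℂ) :
    hsSq (entangledContraction Z) ≤ hsSq Z := by
  have hq' : (0 : ℝ) < q := by exact_mod_cast hq
  have h1 : ∀ a y, ‖entangledContraction Z a y‖ ^ 2 ≤ ∑ b, ‖Z (a, b) (b, y)‖ ^ 2 := by
    intro a y
    have e : ‖entangledContraction Z a y‖ ^ 2 = (q : ℝ)⁻¹ * ‖∑ b, Z (a, b) (b, y)‖ ^ 2 := by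
      simp only [entangledContraction, of_apply]
      rw [← Finset.mul_sum, norm_mul, mul_pow, Complex.norm_real, Real.norm_eq_abs, sq_abs, inv_pow,
        Real.sq_sqrt hq'.le]
    have h2 : ‖∑ b, Z (a, b) (b, y)‖ ^ 2 ≤ q * ∑ b, ‖Z (a, b) (b, y)‖ ^ 2 := by
      refine (pow_le_pow_left₀ (norm_nonneg _) (norm_sum_le _ _) 2).trans ?_
      simpa using sq_sum_le_card_mul_sum_sq (s := Finset.univ) (f := fun b => ‖Z (a, b) (b, y)‖)
    rw [e, inv_mul_le_iff₀ hq']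
    exact h2
  simp only [hsSq, Fintype.sum_prod_type]
  refine Finset.sum_le_sum fun a _ => ?_
  refine (Finset.sum_le_sum fun y _ => h1 a y).trans ?_
  rw [Finset.sum_comm]
  refine Finset.sum_le_sum fun b _ => ?_
  exact Finset.single_le_sum (f := fun b' => ∑ y, ‖Z (a, b) (b', y)‖ ^ 2)
    (fun b' _ => Finset.sum_nonneg fun y _ => sq_nonneg _) (Finset.mem_univ b)

/-- Contraction with Φ does not increase the norm and recovers N from Φ ⊗ N. Hence Φ ⊗ N and the
projection of Z are as close as Φ ⊗ N and Z, whose squared distance is at most 4δ; the constant is 2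
+ 2 · 4. -/
theorem hsSq_sub_entangledProduct_contraction_le [Fintype A₁] [Fintype Y] (hq : 0 < q) {δ : ℝ}
    {X Z : Matrix (A₁ × Fin q) (Fin q × Y) ℂ} {N : Matrix A₁ Y ℂ}
    (hN : hsSq (X - entangledProduct N) ≤ δ) (hZ : hsSq (X - Z) ≤ δ) :
    hsSq (X - entangledProduct (entangledContraction Z)) ≤ 10 * δ := by
  have e : X - entangledProduct (entangledContraction Z) = (X - entangledProduct N)
      + entangledProduct (entangledContraction (entangledProduct N - Z)) := by
    rw [entangledContraction_sub, entangledContraction_entangledProduct hq, entangledProduct_sub]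
    abel
  have e2 : entangledProduct N - Z = (X - Z) + -(X - entangledProduct N) := by abel
  have h1 := hsSq_add_le (X - Z) (-(X - entangledProduct N))
  rw [← e2, hsSq_neg] at h1
  have h2 := hsSq_add_le (X - entangledProduct N)
    (entangledProduct (entangledContraction (entangledProduct N - Z)))
  rw [hsSq_entangledProduct hq] at h2
  have h3 := hsSq_entangledContraction_le hq (entangledProduct N - Z)
  rw [e]
  linarith

end Combine

/-! ### Normalisation and trace norm of pure-state differences -/

theorem sum_normSq_eq_norm_sq {n : Type*} [Fintype n] (x : n → ℂ) :
    ∑ i, ‖x i‖ ^ 2 = ‖WithLp.toLp 2 x‖ ^ 2 := by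
  rw [EuclideanSpace.norm_sq_eq]

/-- Since T preserves norms, w has norm within √δ of 1, and rescaling moves it by at most √δ more.
-/
theorem exists_isUnitVector_near {m n : Type*} [Fintype m] [Fintype n] [Nonempty n]
    (T : (n → ℂ) →ₗ[ℂ] (m → ℂ)) (hT : ∀ y, ∑ i, ‖T y i‖ ^ 2 = ∑ j, ‖y j‖ ^ 2)
    {x : m → ℂ} (hx : IsUnitVector x) {w : n → ℂ} {δ : ℝ} (h : ∑ i, ‖x i - T w i‖ ^ 2 ≤ δ) :
    ∃ w', IsUnitVector w' ∧ ∑ i, ‖x i - T w' i‖ ^ 2 ≤ 4 * δ := by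
  classical
  have hx1 : ‖WithLp.toLp 2 x‖ = 1 := by
    rw [IsUnitVector, sum_normSq_eq_norm_sq] at hx
    exact (pow_eq_one_iff_of_nonneg (norm_nonneg _) two_ne_zero).mp hx
  have hsub : ∀ y : m → ℂ, ∑ i, ‖x i - y i‖ ^ 2 = ‖WithLp.toLp 2 x - WithLp.toLp 2 y‖ ^ 2 :=
    fun y => sum_normSq_eq_norm_sq (x - y)
  have hT' : ∀ y, ‖WithLp.toLp 2 (T y)‖ = ‖WithLp.toLp 2 y‖ := fun y => by
    have := hT y
    rw [sum_normSq_eq_norm_sq, sum_normSq_eq_norm_sq] at this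
    exact (pow_left_inj₀ (norm_nonneg _) (norm_nonneg _) two_ne_zero).mp this
  rw [hsub] at h
  have hrev : (1 - ‖WithLp.toLp 2 w‖) ^ 2 ≤ δ := by
    have h1 := abs_norm_sub_norm_le (WithLp.toLp 2 x) (WithLp.toLp 2 (T w))
    rw [hx1, hT'] at h1
    exact (sq_le_sq' (by linarith [neg_abs_le (1 - ‖WithLp.toLp 2 w‖)])
      ((le_abs_self _).trans h1)).trans h
  -- If w = 0 then δ ≥ 1, and any unit vector serves: two unit vectors have squared distance at most
  -- 4.
  by_cases hw : ‖WithLp.toLp 2 w‖ = 0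
  · obtain ⟨j⟩ := ‹Nonempty n›
    have hu : IsUnitVector (Pi.single j 1 : n → ℂ) := by
      simp [IsUnitVector, Pi.single_apply, apply_ite]
    refine ⟨Pi.single j 1, hu, ?_⟩
    have h1 : ‖WithLp.toLp 2 (T (Pi.single j 1))‖ = 1 := by
      rw [IsUnitVector, sum_normSq_eq_norm_sq] at hu
      rw [hT']
      exact (pow_eq_one_iff_of_nonneg (norm_nonneg _) two_ne_zero).mp hu
    rw [hsub]
    have h2 := norm_sub_le (WithLp.toLp 2 x) (WithLp.toLp 2 (T (Pi.single j 1)))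
    rw [hx1, h1] at h2
    have h3 := pow_le_pow_left₀ (norm_nonneg _) h2 2
    rw [hw] at hrev
    linarith
  · set t := ‖WithLp.toLp 2 w‖
    have ht : 0 < t := lt_of_le_of_ne (norm_nonneg _) (Ne.symm hw)
    refine ⟨((t⁻¹ : ℝ) : ℂ) • w, ?_, ?_⟩
    · rw [IsUnitVector, sum_normSq_eq_norm_sq, WithLp.toLp_smul, norm_smul, Complex.norm_real,
        Real.norm_eq_abs, abs_of_pos (inv_pos.mpr ht)]
      change (t⁻¹ * t) ^ 2 = 1
      rw [inv_mul_cancel₀ hw, one_pow]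
    · rw [hsub, map_smul, WithLp.toLp_smul]
      have e : WithLp.toLp 2 x - ((t⁻¹ : ℝ) : ℂ) • WithLp.toLp 2 (T w)
          = (WithLp.toLp 2 x - WithLp.toLp 2 (T w))
            + ((1 - t⁻¹ : ℝ) : ℂ) • WithLp.toLp 2 (T w) := by
        push_cast
        module
      have h2 := norm_add_le (WithLp.toLp 2 x - WithLp.toLp 2 (T w))
        (((1 - t⁻¹ : ℝ) : ℂ) • WithLp.toLp 2 (T w))
      have h4 : ‖((1 - t⁻¹ : ℝ) : ℂ) • WithLp.toLp 2 (T w)‖ ^ 2 = (1 - t) ^ 2 := by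
        rw [norm_smul, hT', Complex.norm_real, Real.norm_eq_abs, mul_pow, sq_abs]
        change (1 - t⁻¹) ^ 2 * t ^ 2 = _
        field_simp
        ring
      rw [e]
      have h3 := pow_le_pow_left₀ (norm_nonneg _) h2 2
      nlinarith [sq_nonneg (‖WithLp.toLp 2 x - WithLp.toLp 2 (T w)‖
        - ‖((1 - t⁻¹ : ℝ) : ℂ) • WithLp.toLp 2 (T w)‖)]

theorem pureState_eq_vecMulVec {n : Type*} (x : n → ℂ) : pureState x = vecMulVec x (star x) := rfl

theorem mul_pureState_mul_conjTranspose {m n : Type*} [Fintype n] (L : Matrix m n ℂ) (x : n → ℂ) :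
    L * pureState x * Lᴴ = pureState (L *ᵥ x) := by
  rw [pureState_eq_vecMulVec, mul_vecMulVec, vecMulVec_mul, pureState_eq_vecMulVec, star_mulVec]

theorem isDensityMatrix_pureState {n : Type*} [Fintype n] {x : n → ℂ} (hx : IsUnitVector x) :
    IsDensityMatrix (pureState x) := by
  refine ⟨posSemidef_vecMulVec_self_star x, ?_⟩
  have h : (∑ i, (‖x i‖ : ℂ) ^ 2) = 1 := by exact_mod_cast congrArg (fun r : ℝ => (r : ℂ)) hx
  simpa [trace, pureState, Complex.mul_conj'] using h

theorem rank_pureState_sub_le {n : Type*} [Fintype n] [DecidableEq n] (x y : n → ℂ) :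
    (pureState x - pureState y).rank ≤ 2 := by
  have e : pureState x - pureState y
      = (of fun i (b : Bool) => if b then x i else -y i) *
        (of fun (b : Bool) j => if b then star (x j) else star (y j)) := by
    ext i j
    simp [pureState, mul_apply, sub_eq_add_neg]
  rw [e]
  exact (rank_mul_le_left _ _).trans (rank_le_card_width _)

/-- The difference has rank at most 2, so Cauchy-Schwarz over the nonzero singular values loses only
a factor 2 against the squared Hilbert-Schmidt norm, itself at most 4‖x - y‖². -/
theorem traceNorm_pureState_sub_le {n : Type*} [Fintype n] [DecidableEq n] {x y : n → ℂ}
    (hx : IsUnitVector x) (hy : IsUnitVector y) :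
    traceNorm (pureState x - pureState y) ^ 2 ≤ 8 * ∑ i, ‖x i - y i‖ ^ 2 := by
  set H := pureState x - pureState y with hH
  have hHH := isHermitian_conjTranspose_mul_self H
  have he := (posSemidef_conjTranspose_mul_self H).eigenvalues_nonneg
  have hrk : (Finset.univ.filter fun i => hHH.eigenvalues i ≠ 0).card ≤ 2 := by
    rw [← Fintype.card_subtype, ← hHH.rank_eq_card_non_zero_eigs, rank_conjTranspose_mul_self]
    exact rank_pureState_sub_le x y
  have htr : ∑ i, hHH.eigenvalues i = hsSq H := by
    have h1 := hHH.trace_eq_sum_eigenvalues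
    rw [trace_mul_comm, ← ofReal_hsSq] at h1
    refine Complex.ofReal_injective ?_
    rw [h1]
    push_cast
    rfl
  have hsq : hsSq H ≤ 4 * ∑ i, ‖x i - y i‖ ^ 2 := by
    have h1 : ∀ i j, ‖H i j‖ ^ 2 ≤ 2 * (‖x i‖ ^ 2 * ‖x j - y j‖ ^ 2)
        + 2 * (‖x i - y i‖ ^ 2 * ‖y j‖ ^ 2) := by
      intro i j
      have e : H i j = x i * star (x j - y j) + (x i - y i) * star (y j) := by
        simp only [hH, Matrix.sub_apply, pureState, of_apply, star_sub]
        ring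
      rw [e]
      refine (normSq_add_le _ _).trans (le_of_eq ?_)
      simp only [norm_mul, norm_star, mul_pow]
    refine (Finset.sum_le_sum fun i _ => Finset.sum_le_sum fun j _ => h1 i j).trans (le_of_eq ?_)
    unfold IsUnitVector at hx hy
    simp only [Finset.sum_add_distrib, ← Finset.mul_sum, ← Finset.sum_mul, hx, hy]
    ring
  have hcs : traceNorm H ^ 2 ≤ 2 * ∑ i, hHH.eigenvalues i := by
    have e : traceNorm H
        = ∑ i ∈ Finset.univ.filter fun i => hHH.eigenvalues i ≠ 0,
            Real.sqrt (hHH.eigenvalues i) := by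
      rw [traceNorm, Finset.sum_filter_of_ne]
      intro i _ hi h0
      exact hi (by rw [h0, Real.sqrt_zero])
    rw [e]
    refine sq_sum_le_card_mul_sum_sq.trans ?_
    simp only [Real.sq_sqrt (he _)]
    refine mul_le_mul (by exact_mod_cast hrk) (Finset.sum_le_univ_sum_of_nonneg he)
      (Finset.sum_nonneg fun i _ => he i) zero_le_two
  linarith

/-- The canonical maximally entangled vector of two qudits. -/
noncomputable def bellVector (q : ℕ) : Fin q × Fin q → ℂ :=
  fun x => if x.1 = x.2 then ((Real.sqrt q)⁻¹ : ℝ) else 0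

theorem isMaximallyEntangled_bellVector {q : ℕ} (hq : 0 < q) :
    IsMaximallyEntangled (bellVector q) := by
  have hq' : (0 : ℝ) < q := by exact_mod_cast hq
  have hsq : (Real.sqrt q)⁻¹ * (Real.sqrt q)⁻¹ = (q : ℝ)⁻¹ := by
    rw [← mul_inv, Real.mul_self_sqrt hq'.le]
  constructor
  · have h : ∀ a b : Fin q, ‖bellVector q (a, b)‖ ^ 2 = if a = b then (q : ℝ)⁻¹ else 0 := by
      intro a b
      simp only [bellVector]
      split_ifs
      · rw [Complex.norm_real, Real.norm_eq_abs, sq_abs, sq, hsq]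
      · simp
    rw [IsUnitVector, Fintype.sum_prod_type]
    simp [h, hq'.ne']
  · have h : traceRight (pureState (bellVector q))
        = diagonal fun _ => (((q : ℝ)⁻¹ : ℝ) : ℂ) := by
      ext a b
      simp only [traceRight, pureState, bellVector, of_apply, diagonal_apply]
      rw [← hsq]
      by_cases hab : a = b
      · simp [hab]
      · simp [hab, apply_ite]
    have hH : (diagonal fun _ : Fin q => (((q : ℝ)⁻¹ : ℝ) : ℂ)).IsHermitian := by
      rw [IsHermitian, diagonal_conjTranspose]
      congr 1
      ext i
      simp
    rw [h, entropy_eq_sum_roots hH, charpoly_diagonal, Finset.prod_const, Polynomial.roots_pow,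
      Polynomial.roots_X_sub_C, Multiset.map_nsmul, Multiset.sum_nsmul]
    simp only [Multiset.map_singleton, Multiset.sum_singleton, Finset.card_univ, Fintype.card_fin,
      Complex.ofReal_re, Real.negMulLog, Real.log_inv, nsmul_eq_mul]
    field_simp

/-! ### Bipartite views of a four-party vector -/

section Views

variable {q : ℕ} {A D A' D' : Type*}

/-- A four-party vector as a matrix from `BCD` to `A`. -/
def leftView (ψ : Four q A D → ℂ) : Matrix A (Fin q × (Fin q × D)) ℂ :=
  of fun a k => ψ ((a, k.1), k.2)

/-- A four-party vector as a matrix from `CAB` to `D`. -/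
def rightView (ψ : Four q A D → ℂ) : Matrix D (Fin q × (A × Fin q)) ℂ :=
  of fun d k => ψ (k.2, (k.1, d))

/-- A four-party vector as a matrix from `CD` to `AB`. -/
def cutView (ψ : Four q A D → ℂ) : Matrix (A × Fin q) (Fin q × D) ℂ :=
  of fun x y => ψ (x, y)

theorem traceRight_pureState [Fintype D] (ψ : Four q A D → ℂ) :
    traceRight (pureState ψ) = cutView ψ * (cutView ψ)ᴴ := by
  ext x y
  simp [traceRight, pureState, cutView, mul_apply]

theorem entropy_reducedGram_leftView [Fintype A] [Fintype D] [DecidableEq A] [DecidableEq D]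
    (ψ : Four q A D → ℂ) :
    entropy (reducedGram (leftView ψ)) = entropy (traceRight (pureState ψ)) := by
  have h : reducedGram (leftView ψ) = (cutView ψ)ᴴ * cutView ψ := by
    ext x y
    simp only [reducedGram_apply, leftView, cutView, mul_apply, conjTranspose_apply, of_apply,
      Fintype.sum_prod_type]
    rw [Finset.sum_comm]
  rw [h, traceRight_pureState, entropy_mul_conjTranspose_self]

theorem entropy_reducedGram_rightView [Fintype A] [Fintype D] [DecidableEq A]
    (ψ : Four q A D → ℂ) :
    entropy (reducedGram (rightView ψ)) = entropy (traceRight (pureState ψ)) := by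
  have h : reducedGram (rightView ψ) = (cutView ψ * (cutView ψ)ᴴ)ᵀ := by
    ext x y
    simp only [reducedGram_apply, rightView, cutView, mul_apply, conjTranspose_apply, of_apply,
      Fintype.sum_prod_type, transpose_apply, mul_comm]
  rw [h, traceRight_pureState, entropy_transpose (isHermitian_mul_conjTranspose_self _)]

theorem gate_mulVec_apply [Fintype A] [Fintype D] [DecidableEq A] [DecidableEq D]
    (u : Matrix (Fin q × Fin q) (Fin q × Fin q) ℂ) (ψ : Four q A D → ℂ)
    (a : A) (b c : Fin q) (d : D) :
    (gate u *ᵥ ψ) ((a, b), (c, d)) = ∑ k, ψ ((a, k.1), (k.2, d)) * uᵀ k (b, c) := by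
  simp only [mulVec, dotProduct, gate, of_apply, Fintype.sum_prod_type, transpose_apply]
  rw [Finset.sum_eq_single a]
  · refine Finset.sum_congr rfl fun b' _ => Finset.sum_congr rfl fun c' _ => ?_
    simp [mul_comm]
  · intro a' _ ha
    simp [Ne.symm ha]
  · simp

theorem mul_transpose_gram {X : Type*} {κ : Type*} [Fintype κ] [DecidableEq κ] {u : Matrix κ κ ℂ}
    (hu : u ∈ unitaryGroup κ ℂ) (T : Matrix X κ ℂ) : (T * uᵀ) * (T * uᵀ)ᴴ = T * Tᴴ := by
  have h : uᵀ * (uᵀ)ᴴ = 1 := by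
    have h1 : uᴴ * u = 1 := (mem_unitaryGroup_iff').mp hu
    have h2 := congrArg transpose h1
    rwa [transpose_mul, transpose_one] at h2
  rw [conjTranspose_mul, Matrix.mul_assoc, ← Matrix.mul_assoc uᵀ, h, Matrix.one_mul]

/-- The reduced state of `A` is a sum over basis states of `D`. In each summand the gate is right
multiplication by the unitary uᵀ, which cancels. -/
theorem leftView_gate_gram [Fintype A] [Fintype D] [DecidableEq A] [DecidableEq D]
    {u : Matrix (Fin q × Fin q) (Fin q × Fin q) ℂ}
    (hu : u ∈ unitaryGroup (Fin q × Fin q) ℂ) (ψ : Four q A D → ℂ) :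
    leftView (gate u *ᵥ ψ) * (leftView (gate u *ᵥ ψ))ᴴ = leftView ψ * (leftView ψ)ᴴ := by
  let T : (Four q A D → ℂ) → D → Matrix A (Fin q × Fin q) ℂ :=
    fun φ d => of fun a k => φ ((a, k.1), (k.2, d))
  have h : ∀ φ, leftView φ * (leftView φ)ᴴ = ∑ d, T φ d * (T φ d)ᴴ := by
    intro φ
    ext a a'
    simp only [leftView, T, Matrix.sum_apply, mul_apply, conjTranspose_apply, of_apply,
      Fintype.sum_prod_type]
    rw [Finset.sum_comm]
    simp only [Finset.sum_comm (s := (Finset.univ : Finset D))]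
    rw [Finset.sum_comm]
  have h2 : ∀ d, T (gate u *ᵥ ψ) d = T ψ d * uᵀ := by
    intro d
    ext a k
    simp only [T, of_apply, gate_mulVec_apply, mul_apply]
  simp only [h, h2, mul_transpose_gram hu]

theorem rightView_gate_gram [Fintype A] [Fintype D] [DecidableEq A] [DecidableEq D]
    {u : Matrix (Fin q × Fin q) (Fin q × Fin q) ℂ}
    (hu : u ∈ unitaryGroup (Fin q × Fin q) ℂ) (ψ : Four q A D → ℂ) :
    rightView (gate u *ᵥ ψ) * (rightView (gate u *ᵥ ψ))ᴴ = rightView ψ * (rightView ψ)ᴴ := by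
  let T : (Four q A D → ℂ) → A → Matrix D (Fin q × Fin q) ℂ :=
    fun φ a => of fun d k => φ ((a, k.1), (k.2, d))
  have h : ∀ φ, rightView φ * (rightView φ)ᴴ = ∑ a, T φ a * (T φ a)ᴴ := by
    intro φ
    ext d d'
    simp only [rightView, T, Matrix.sum_apply, mul_apply, conjTranspose_apply, of_apply,
      Fintype.sum_prod_type]
    rw [Finset.sum_comm]
    refine Finset.sum_congr rfl fun a _ => ?_
    rw [Finset.sum_comm]
  have h2 : ∀ a, T (gate u *ᵥ ψ) a = T ψ a * uᵀ := by
    intro a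
    ext d k
    simp only [T, of_apply, gate_mulVec_apply, mul_apply]
  simp only [h, h2, mul_transpose_gram hu]

theorem hsSq_leftView [Fintype A] [Fintype D] (ψ : Four q A D → ℂ) :
    hsSq (leftView ψ) = ∑ x, ‖ψ x‖ ^ 2 := by
  simp only [hsSq, leftView, of_apply, Fintype.sum_prod_type]

theorem hsSq_rightView [Fintype A] [Fintype D] (ψ : Four q A D → ℂ) :
    hsSq (rightView ψ) = ∑ x, ‖ψ x‖ ^ 2 := by
  simp only [hsSq, rightView, of_apply, ← Fintype.sum_prod_type']
  exact Fintype.sum_equiv ⟨fun x => (x.2.2, (x.2.1, x.1)), fun x => (x.2.2, (x.2.1, x.1)),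
    fun _ => rfl, fun _ => rfl⟩ _ _ fun _ => rfl

theorem trace_gram_eq_one {m n : Type*} [Fintype m] [Fintype n] {M : Matrix m n ℂ}
    (h : hsSq M = 1) : (Mᴴ * M).trace = 1 := by
  rw [trace_mul_comm, ← ofReal_hsSq, h, Complex.ofReal_one]

theorem localOp_mulVec_apply [Fintype A] [Fintype D]
    (VA : Matrix A' A ℂ) (VD : Matrix D' D ℂ) (ψ : Four q A D → ℂ)
    (a' : A') (b c : Fin q) (d' : D') :
    (localOp q VA VD *ᵥ ψ) ((a', b), (c, d'))
      = ∑ a, ∑ d, VA a' a * VD d' d * ψ ((a, b), (c, d)) := by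
  simp only [mulVec, dotProduct, localOp, kroneckerMap_apply, one_apply, Fintype.sum_prod_type]
  refine Finset.sum_congr rfl fun a _ => ?_
  rw [Finset.sum_eq_single b, Finset.sum_eq_single c]
  · simp
  · intro c' _ hc
    simp [Ne.symm hc]
  · simp
  · intro b' _ hb
    simp [Ne.symm hb]
  · simp

theorem leftView_localOp [Fintype A] [Fintype D]
    (VA : Matrix A' A ℂ) (VD : Matrix D' D ℂ) (ψ : Four q A D → ℂ) :
    leftView (localOp q VA VD *ᵥ ψ) = VA * leftView ψ *
      ((1 : Matrix (Fin q) (Fin q) ℂ) ⊗ₖ ((1 : Matrix (Fin q) (Fin q) ℂ) ⊗ₖ VDᵀ)) := by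
  ext a' ⟨b, c, d'⟩
  change (localOp q VA VD *ᵥ ψ) ((a', b), (c, d')) = _
  rw [localOp_mulVec_apply, Matrix.mul_assoc, mul_apply]
  refine Finset.sum_congr rfl fun a _ => ?_
  simp [leftView, mul_apply, Fintype.sum_prod_type, one_apply, Finset.mul_sum, mul_assoc, mul_comm]

theorem rightView_localOp [Fintype A] [Fintype D]
    (VA : Matrix A' A ℂ) (VD : Matrix D' D ℂ) (ψ : Four q A D → ℂ) :
    rightView (localOp q VA VD *ᵥ ψ) = VD * rightView ψ *
      ((1 : Matrix (Fin q) (Fin q) ℂ) ⊗ₖ (VAᵀ ⊗ₖ (1 : Matrix (Fin q) (Fin q) ℂ))) := by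
  ext d' ⟨c, a', b⟩
  change (localOp q VA VD *ᵥ ψ) ((a', b), (c, d')) = _
  rw [localOp_mulVec_apply, Matrix.mul_assoc, mul_apply, Finset.sum_comm]
  refine Finset.sum_congr rfl fun d _ => ?_
  simp [rightView, mul_apply, Fintype.sum_prod_type, one_apply, Finset.mul_sum, mul_assoc,
    mul_comm, mul_left_comm]

theorem transpose_mul_conjTranspose {m n : Type*} [Fintype m] [Fintype n] [DecidableEq n]
    {V : Matrix m n ℂ} (hV : Vᴴ * V = 1) : Vᵀ * Vᵀᴴ = 1 := by
  have h := congrArg transpose hV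
  rwa [transpose_mul, transpose_one] at h

/-- Allows the estimate on one side to survive the isometry applied on the other. -/
theorem hsSq_sub_entangledProduct_mul_kronecker {A₁ Y Y' : Type*} [Fintype A₁] [Fintype Y]
    [Fintype Y'] [DecidableEq Y] {W : Matrix Y Y' ℂ} (hW : W * Wᴴ = 1)
    (X : Matrix (A₁ × Fin q) (Fin q × Y) ℂ) (N : Matrix A₁ Y ℂ) :
    hsSq (X * ((1 : Matrix (Fin q) (Fin q) ℂ) ⊗ₖ W) - entangledProduct (N * W))
      = hsSq (X - entangledProduct N) := by
  have hk : ((1 : Matrix (Fin q) (Fin q) ℂ) ⊗ₖ W) * ((1 : Matrix (Fin q) (Fin q) ℂ) ⊗ₖ W)ᴴ = 1 := by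
    rw [conjTranspose_kronecker, ← mul_kronecker_mul, hW]
    simp
  rw [← hsSq_mul_of_coisometry hk (X - _), Matrix.sub_mul, entangledProduct_mul_kronecker]

end Views

/-! ### Simultaneous distillation on both sides -/

section Distill

variable {q : ℕ} {A₁ D₁ : Type*}

/-- Tensoring a vector of `A₁D₁` with maximally entangled vectors of `A₂B` and `D₂C`. -/
noncomputable def distilledVector (q : ℕ) (A₁ D₁ : Type*) :
    (A₁ × D₁ → ℂ) →ₗ[ℂ] (Four q (A₁ × Fin q) (D₁ × Fin q) → ℂ) where
  toFun ω := fun x => bellVector q (x.1.1.2, x.1.2) * ω (x.1.1.1, x.2.2.1) *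
    bellVector q (x.2.2.2, x.2.1)
  map_add' ω ω' := by
    ext x
    simp only [Pi.add_apply]
    ring
  map_smul' c ω := by
    ext x
    simp only [Pi.smul_apply, smul_eq_mul, RingHom.id_apply]
    ring

theorem distilled_pureState (ω : A₁ × D₁ → ℂ) :
    distilled (bellVector q) (pureState ω) (bellVector q)
      = pureState (distilledVector q A₁ D₁ ω) := by
  ext x y
  simp only [distilled, pureState, distilledVector, of_apply, LinearMap.coe_mk, AddHom.coe_mk,
    star_mul']
  ring

theorem sum_normSq_distilledVector [Fintype A₁] [Fintype D₁] (hq : 0 < q) (ω : A₁ × D₁ → ℂ) :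
    ∑ x, ‖distilledVector q A₁ D₁ ω x‖ ^ 2 = ∑ x, ‖ω x‖ ^ 2 := by
  have h := (isMaximallyEntangled_bellVector hq).1
  rw [IsUnitVector, Fintype.sum_prod_type] at h
  have e : ∀ (a : A₁) (d : D₁), ∑ a₂, ∑ b, ∑ c, ∑ d₂,
      ‖distilledVector q A₁ D₁ ω (((a, a₂), b), (c, (d, d₂)))‖ ^ 2 = ‖ω (a, d)‖ ^ 2 := by
    intro a d
    simp only [distilledVector, LinearMap.coe_mk, AddHom.coe_mk, norm_mul, mul_pow,
      ← Finset.mul_sum]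
    rw [Finset.sum_comm] at h
    simp only [h, mul_one]
    rw [Finset.sum_comm] at h
    simp only [← Finset.sum_mul, h, one_mul]
  rw [Fintype.sum_prod_type (f := fun x => ‖ω x‖ ^ 2)]
  simp only [← e, Fintype.sum_prod_type]
  refine Finset.sum_congr rfl fun a _ => ?_
  rw [Finset.sum_comm (γ := D₁)]
  refine Finset.sum_congr rfl fun a₂ _ => ?_
  rw [Finset.sum_comm (γ := D₁)]
  refine Finset.sum_congr rfl fun b _ => ?_
  rw [Finset.sum_comm (γ := D₁)]

theorem exists_distilledVector_near [Fintype A₁] [Fintype D₁] (hq : 0 < q) {δ : ℝ}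
    {ξ : Four q (A₁ × Fin q) (D₁ × Fin q) → ℂ}
    {N : Matrix A₁ (Fin q × (D₁ × Fin q)) ℂ} {N' : Matrix D₁ ((A₁ × Fin q) × Fin q) ℂ}
    (hN : hsSq (leftView ξ - entangledProduct N) ≤ δ)
    (hN' : hsSq (rightView ξ - entangledProduct N') ≤ δ) :
    ∃ ω : A₁ × D₁ → ℂ, ∑ x, ‖ξ x - distilledVector q A₁ D₁ ω x‖ ^ 2 ≤ 10 * δ := by
  -- ζ is the approximation Φ ⊗ N' from the `D` side. Its partial inner product with Φ on `A₂B`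
  -- still contains the factor Φ on `D₂C`; what remains is ω.
  let ζ : Four q (A₁ × Fin q) (D₁ × Fin q) → ℂ :=
    fun z => entangledProduct N' z.2.2 (z.2.1, z.1)
  let ω : A₁ × D₁ → ℂ := fun y => ∑ b, ((Real.sqrt q)⁻¹ : ℝ) * N' y.2 ((y.1, b), b)
  have h1 : hsSq (leftView ξ - leftView ζ) ≤ δ := by
    have e1 : leftView ξ - leftView ζ = leftView (ξ - ζ) := rfl
    have e2 : rightView ξ - entangledProduct N' = rightView (ξ - ζ) := rfl
    rw [e1, hsSq_leftView, ← hsSq_rightView, ← e2]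
    exact hN'
  have h2 := hsSq_sub_entangledProduct_contraction_le hq hN h1
  have h3 : entangledProduct (entangledContraction (leftView ζ))
      = leftView (distilledVector q A₁ D₁ ω) := by
    ext ⟨a₁, a₂⟩ ⟨b, c, d₁, d₂⟩
    simp only [entangledProduct, entangledContraction, leftView, distilledVector, bellVector, ζ, ω,
      of_apply, LinearMap.coe_mk, AddHom.coe_mk]
    by_cases hab : a₂ = b
    · by_cases hdc : d₂ = c
      · simp only [hab, hdc, if_true, Finset.mul_sum, Finset.sum_mul]
        exact Finset.sum_congr rfl fun _ _ => by ring
      · simp [hdc]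
    · simp [hab]
  refine ⟨ω, ?_⟩
  rw [h3] at h2
  have e : leftView ξ - leftView (distilledVector q A₁ D₁ ω)
      = leftView (ξ - distilledVector q A₁ D₁ ω) := rfl
  rwa [e, hsSq_leftView] at h2

end Distill

end QuditGrowth

/-! ### Assembly -/

theorem lemma2 :
    ∃ K : ℝ, 0 < K ∧
      ∀ (q : ℕ) (_hq : 2 ≤ q)
        (A D A₁ D₁ : Type*) [Fintype A] [Fintype D] [Fintype A₁] [Fintype D₁]
        [DecidableEq A] [DecidableEq D] [DecidableEq A₁] [DecidableEq D₁]
        -- the systems `A`, `D` fit into `A₁A₂`, `D₁D₂` (equality: genuine partitions)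
        (_hA : Fintype.card A ≤ Fintype.card (A₁ × Fin q))
        (_hD : Fintype.card D ≤ Fintype.card (D₁ × Fin q))
        -- the pure input state, the gate on `BC`, and the growth assumption
        (ψ : QuditGrowth.Four q A D → ℂ) (_hψ : QuditGrowth.IsUnitVector ψ)
        (u : Matrix (Fin q × Fin q) (Fin q × Fin q) ℂ)
        (_hu : u ∈ Matrix.unitaryGroup (Fin q × Fin q) ℂ)
        (ε : ℝ)
        (_hε : QuditGrowth.entropy (QuditGrowth.traceRight
              (QuditGrowth.gate u * QuditGrowth.pureState ψ *
                (QuditGrowth.gate u).conjTranspose))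
            - QuditGrowth.entropy (QuditGrowth.traceRight (QuditGrowth.pureState ψ))
            = 2 * Real.log q - ε),
        ∃ (VA : Matrix (A₁ × Fin q) A ℂ) (VD : Matrix (D₁ × Fin q) D ℂ)
          (α β : Fin q × Fin q → ℂ) (σ : Matrix (A₁ × D₁) (A₁ × D₁) ℂ),
          -- local isometries, which are unitary for genuine partitions
          VA.conjTranspose * VA = 1 ∧
          (Fintype.card A = Fintype.card (A₁ × Fin q) → VA * VA.conjTranspose = 1) ∧
          VD.conjTranspose * VD = 1 ∧
          (Fintype.card D = Fintype.card (D₁ × Fin q) → VD * VD.conjTranspose = 1) ∧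
          QuditGrowth.IsMaximallyEntangled α ∧
          QuditGrowth.IsMaximallyEntangled β ∧
          QuditGrowth.IsDensityMatrix σ ∧
          QuditGrowth.traceNorm
            (QuditGrowth.localOp q VA VD * QuditGrowth.pureState ψ *
                (QuditGrowth.localOp q VA VD).conjTranspose
              - QuditGrowth.distilled α σ β) ≤ K * Real.sqrt ε := by
  -- 640 = 2 · 10 · 4 · 8: the one-sided estimate, merging, normalisation, and passage to the
  -- squared trace norm.
  refine ⟨Real.sqrt 640, by positivity, ?_⟩
  intro q hq A D A₁ D₁ _ _ _ _ _ _ _ _ hA hD ψ hψ u hu ε hε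
  have hq0 : 0 < q := by omega
  rw [QuditGrowth.mul_pureState_mul_conjTranspose] at hε
  have hl := QuditGrowth.hsSq_leftView ψ
  have hr := QuditGrowth.hsSq_rightView ψ
  have hψ1 : ∑ x, ‖ψ x‖ ^ 2 = 1 := hψ
  rw [hψ1] at hl hr
  obtain ⟨VA, NA, hVA, hNA⟩ := QuditGrowth.exists_isometry_near_of_entropy_growth hq0 hA
    (QuditGrowth.leftView_gate_gram hu ψ) (QuditGrowth.trace_gram_eq_one hl) (ε := ε) (by
      rw [QuditGrowth.entropy_reducedGram_leftView, QuditGrowth.entropy_reducedGram_leftView, hε])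
  obtain ⟨VD, ND, hVD, hND⟩ := QuditGrowth.exists_isometry_near_of_entropy_growth hq0 hD
    (QuditGrowth.rightView_gate_gram hu ψ) (QuditGrowth.trace_gram_eq_one hr) (ε := ε) (by
      rw [QuditGrowth.entropy_reducedGram_rightView, QuditGrowth.entropy_reducedGram_rightView, hε])
  have hWD : ((1 : Matrix (Fin q) (Fin q) ℂ) ⊗ₖ VD.transpose) *
      ((1 : Matrix (Fin q) (Fin q) ℂ) ⊗ₖ VD.transpose).conjTranspose = 1 := by
    rw [Matrix.conjTranspose_kronecker, ← Matrix.mul_kronecker_mul,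
      QuditGrowth.transpose_mul_conjTranspose hVD]
    simp
  have hWA : (VA.transpose ⊗ₖ (1 : Matrix (Fin q) (Fin q) ℂ)) *
      (VA.transpose ⊗ₖ (1 : Matrix (Fin q) (Fin q) ℂ)).conjTranspose = 1 := by
    rw [Matrix.conjTranspose_kronecker, ← Matrix.mul_kronecker_mul,
      QuditGrowth.transpose_mul_conjTranspose hVA]
    simp
  rw [← QuditGrowth.hsSq_sub_entangledProduct_mul_kronecker hWD,
    ← QuditGrowth.leftView_localOp] at hNA
  rw [← QuditGrowth.hsSq_sub_entangledProduct_mul_kronecker hWA,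
    ← QuditGrowth.rightView_localOp] at hND
  have hξ : QuditGrowth.IsUnitVector ((QuditGrowth.localOp q VA VD).mulVec ψ) := by
    rw [QuditGrowth.IsUnitVector, ← QuditGrowth.hsSq_leftView, QuditGrowth.leftView_localOp,
      QuditGrowth.hsSq_mul_of_coisometry, QuditGrowth.hsSq_mul_of_isometry hVA, hl]
    rw [Matrix.conjTranspose_kronecker, ← Matrix.mul_kronecker_mul, hWD]
    simp
  obtain ⟨ω₀, hω₀⟩ := QuditGrowth.exists_distilledVector_near hq0 hNA hND
  -- The normalisation step needs some unit vector on `A₁D₁`; an empty index set would leave no room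
  -- for the unit vector ψ.
  have : Nonempty (A₁ × D₁) := by
    by_contra hne
    rw [not_nonempty_iff] at hne
    have hE : IsEmpty (QuditGrowth.Four q (A₁ × Fin q) (D₁ × Fin q)) :=
      ⟨fun x => hne.false (x.1.1.1, x.2.2.1)⟩
    have : (0 : ℝ) = 1 := by
      rw [← hξ, Finset.univ_eq_empty, Finset.sum_empty]
    exact zero_ne_one this
  obtain ⟨ω, hω, hnear⟩ := QuditGrowth.exists_isUnitVector_near
    (QuditGrowth.distilledVector q A₁ D₁) (QuditGrowth.sum_normSq_distilledVector hq0) hξ hω₀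
  have hent := QuditGrowth.isMaximallyEntangled_bellVector hq0
  refine ⟨VA, VD, QuditGrowth.bellVector q, QuditGrowth.bellVector q, QuditGrowth.pureState ω, hVA,
    fun h => (Matrix.mul_eq_one_comm_of_equiv (Fintype.equivOfCardEq h)).mp hVA, hVD,
    fun h => (Matrix.mul_eq_one_comm_of_equiv (Fintype.equivOfCardEq h)).mp hVD, hent, hent,
    QuditGrowth.isDensityMatrix_pureState hω, ?_⟩
  have hT : QuditGrowth.IsUnitVector (QuditGrowth.distilledVector q A₁ D₁ ω) :=
    (QuditGrowth.sum_normSq_distilledVector hq0 ω).trans hω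
  rw [QuditGrowth.mul_pureState_mul_conjTranspose, QuditGrowth.distilled_pureState,
    ← Real.sqrt_mul (by norm_num)]
  refine Real.le_sqrt_of_sq_le ((QuditGrowth.traceNorm_pureState_sub_le hξ hT).trans ?_)
  linarith
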